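/- Let $n\ge 1$ agents $\mathcal V=\{1,\dots,n\}$ act over rounds $t=1,\dots,T$, $T\ge 2$, on a nonempty compact convex set $X\subset\mathbb R^d$ with $\|x-z\|\le M$ for all $x,z\in X$ (Euclidean norms). For each round $t$ let $\mathcal G_t$ be a strongly connected directed graph on $\mathcal V$, let $\mathcal N_i(t)$ consist of $i$ and of all $j$ with an edge $(j,i)$ of $\mathcal G_t$, and let $A_t\in\mathbb R^{n\times n}$ be doubly stochastic with $[A_t]_{ij}>0$ if $j\in\mathcal N_i(t)$ and $[A_t]_{ij}=0$ otherwise, all positive entries being at least a constant $\zeta>0$ (the same for all $t$). For each $i\in\mathcal V$ and $t\le T$ let $f_{i,t}$ be a real function that is convex on $X$, differentiable at the points of $X$, and satisfies, with constants $L_X,G_X>0$ and for all $x,z\in X$, $$|f_{i,t}(x)-f_{i,t}(z)|\le L_X\|x-z\|,\qquad f_{i,t}(x)-f_{i,t}(z)\le\langle\nabla f_{i,t}(z),x-z\rangle+\tfrac{G_X}{2}\|x-z\|^2 .$$ Let $F_t=\sum_{i=1}^n f_{i,t}$, $x_t^*\in\arg\min_{x\in X}F_t(x)$, and $$H_T=\sum_{t=1}^{T-1}\max_{i\in\mathcal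 V}\max_{x\in X}|f_{i,t+1}(x)-f_{i,t}(x)| .$$ Let $\rho\ge1$, let $2\le K_1\le K_2\le\dots\le K_T$ be integers and $\alpha_t=1/(\rho K_t)$. The DOMFW algorithm starts from points $x_{i,1}\in X$; in round $t$ it sets $x_{i,t}^1=x_{i,t}$, computes for $k=1,\dots,K_t$ and every agent $i$ $$\hat x_{i,t}^k=\sum_{j\in\mathcal N_i(t)}[A_t]_{ij}x_{j,t}^k,\qquad \widehat\nabla f_{i,t}^k=\sum_{j\in\mathcal N_i(t)}[A_t]_{ij}\overline\nabla f_{j,t}^k,$$ $$\overline\nabla f_{i,t}^1=\nabla f_{i,t}(\hat x_{i,t}^1),\qquad \overline\nabla f_{i,t}^k=\widehat\nabla f_{i,t}^{k-1}+\nabla f_{i,t}(\hat x_{i,t}^k)-\nabla f_{i,t}(\hat x_{i,t}^{k-1})\quad(k\ge2),$$ $$v_{i,t}^k\in\arg\min_{x\in X}\langle x,\widehat\nabla f_{i,t}^k\rangle,\qquad x_{i,t}^{k+1}=\hat x_{i,t}^k+\alpha_t(v_{i,t}^k-\hat x_{i,t}^k),$$ and then puts $x_{i,t+1}=x_{i,t}^{K_t+1}$.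 Then for every agent $j\in\mathcal V$ the dynamic regret satisfies $$\sum_{t=1}^T F_t(x_{j,t})-\sum_{t=1}^T F_t(x_t^*)\le E_1+E_2H_T+E_3\sum_{t=1}^T\frac1{K_t},$$ where, with $\sigma_1=1-\frac{\zeta}{4n^2}$, $\Gamma_1=\sigma_1^{-1}$, $c_\rho=(1-e^{-1/\rho})^{-1}$ and $x_{avg,1}=\frac1n\sum_{i=1}^n x_{i,1}$, $$E_1=\frac{n^2L_X\Gamma_1}{1-\sigma_1^{K_1}}\sum_{i=1}^n\|x_{i,1}\|+nL_X\sum_{i=1}^n\|x_{i,1}-x_{avg,1}\|+nL_XMc_\rho,\qquad E_2=2nc_\rho,$$ $$E_3=2M\Big(\frac{D_1}{\rho}+\frac{D_2}{\rho^2}\Big)c_\rho+\frac{nG_XM^2}{2\rho}c_\rho+\frac{n^2L_XM}{\rho}\Big(\frac{n\Gamma_1}{\sigma_1(1-\sigma_1)(1-\sigma_1^{K_1})}+2\Big),$$ $$D_1=\Big(\frac{2n\Gamma_1G_X}{1-\sigma_1}+G_X\Big)\Big(nM+\frac{n\Gamma_1}{1-\sigma_1}\sum_{j=1}^n(\|x_{j,1}\|+M)\Big)+\frac{n^2\Gamma_1L_X}{1-\sigma_1},$$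 $$D_2=\frac{2n^2\Gamma_1G_XM}{1-\sigma_1}\Big(\frac{n\Gamma_1}{1-\sigma_1}+3\Big)+2nMG_X .$$ -/

import Mathlib

noncomputable section

namespace DOMFW

/-- The inner neighbours of agent `i`: the agents `j` with an edge from `j` to `i`, and `i`. -/
def inNeighbors {n : ℕ} (G : Digraph (Fin n)) (i : Fin n) : Finset (Fin n) :=
  open Classical in Finset.univ.filter (fun j => G.Adj j i ∨ j = i)

/-- Every node can be reached from every node along directed edges. -/
def StronglyConnected {n : ℕ} (G : Digraph (Fin n)) : Prop :=
  ∀ i j : Fin n, Relation.ReflTransGen G.Adj i j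

/-- The communication network of one round: a strongly connected directed graph `G` with a
doubly stochastic weight matrix `A` whose positive entries are exactly those at inner neighbours,
all of them at least `ζ`. -/
structure IsNetwork {n : ℕ} (ζ : ℝ) (G : Digraph (Fin n)) (A : Matrix (Fin n) (Fin n) ℝ) :
    Prop where
  weight_pos : ∀ i j, j ∈ inNeighbors G i → 0 < A i j
  weight_zero : ∀ i j, j ∉ inNeighbors G i → A i j = 0
  weight_lower : ∀ i j, 0 < A i j → ζ ≤ A i j
  connected : StronglyConnected G
  doubly : A ∈ doublyStochastic ℝ (Fin n)

/-- The assumptions on one loss function on the constraint set `X`: convex, differentiable,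
`L`-Lipschitz and `GX`-smooth. -/
structure IsLoss {d : ℕ} (X : Set (EuclideanSpace ℝ (Fin d))) (L GX : ℝ)
    (f : EuclideanSpace ℝ (Fin d) → ℝ) : Prop where
  convex : ConvexOn ℝ X f
  diff : ∀ x ∈ X, DifferentiableAt ℝ f x
  lipschitz : ∀ x ∈ X, ∀ z ∈ X, |f x - f z| ≤ L * ‖x - z‖
  smooth : ∀ x ∈ X, ∀ z ∈ X,
    f x - f z ≤ inner ℝ (gradient f z) (x - z) + GX / 2 * ‖x - z‖ ^ 2

/-- The variables of the algorithm; rounds `t` and inner iterations `k` are numbered from 1. -/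
structure Variables (n d : ℕ) where
  /-- the decision of agent `i` in round `t` -/
  x : Fin n → ℕ → EuclideanSpace ℝ (Fin d)
  /-- the state of agent `i` at the start of inner iteration `k` of round `t` -/
  state : Fin n → ℕ → ℕ → EuclideanSpace ℝ (Fin d)
  /-- the weighted average of the states of the inner neighbours -/
  mixed : Fin n → ℕ → ℕ → EuclideanSpace ℝ (Fin d)
  /-- the gradient estimate before mixing -/
  gradBar : Fin n → ℕ → ℕ → EuclideanSpace ℝ (Fin d)
  /-- the gradient estimate after mixing -/
  gradHat : Fin n → ℕ → ℕ → EuclideanSpace ℝ (Fin d)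
  /-- the answer of the linear oracle -/
  v : Fin n → ℕ → ℕ → EuclideanSpace ℝ (Fin d)

/-- `w` is a run of the algorithm over rounds `1, …, T` with `K t` inner iterations
and step `α t` in round `t`. The linear oracle may return any minimizer. -/
structure IsRun {n d : ℕ} (X : Set (EuclideanSpace ℝ (Fin d))) (T : ℕ)
    (G : ℕ → Digraph (Fin n)) (A : ℕ → Matrix (Fin n) (Fin n) ℝ)
    (f : Fin n → ℕ → EuclideanSpace ℝ (Fin d) → ℝ) (K : ℕ → ℕ) (α : ℕ → ℝ)
    (w : Variables n d) : Prop where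
  init : ∀ i, w.x i 1 ∈ X
  state_one : ∀ i, ∀ t ∈ Set.Icc 1 T, w.state i t 1 = w.x i t
  mixed_eq : ∀ i, ∀ t ∈ Set.Icc 1 T, ∀ k ∈ Set.Icc 1 (K t),
    w.mixed i t k = ∑ j ∈ inNeighbors (G t) i, A t i j • w.state j t k
  gradBar_one : ∀ i, ∀ t ∈ Set.Icc 1 T,
    w.gradBar i t 1 = gradient (f i t) (w.mixed i t 1)
  gradBar_succ : ∀ i, ∀ t ∈ Set.Icc 1 T, ∀ k ∈ Set.Ico 1 (K t),
    w.gradBar i t (k + 1) = w.gradHat i t k + gradient (f i t) (w.mixed i t (k + 1))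
      - gradient (f i t) (w.mixed i t k)
  gradHat_eq : ∀ i, ∀ t ∈ Set.Icc 1 T, ∀ k ∈ Set.Icc 1 (K t),
    w.gradHat i t k = ∑ j ∈ inNeighbors (G t) i, A t i j • w.gradBar j t k
  v_mem : ∀ i, ∀ t ∈ Set.Icc 1 T, ∀ k ∈ Set.Icc 1 (K t), w.v i t k ∈ X
  v_min : ∀ i, ∀ t ∈ Set.Icc 1 T, ∀ k ∈ Set.Icc 1 (K t), ∀ y ∈ X,
    inner ℝ (w.v i t k) (w.gradHat i t k) ≤ inner ℝ y (w.gradHat i t k)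
  state_succ : ∀ i, ∀ t ∈ Set.Icc 1 T, ∀ k ∈ Set.Icc 1 (K t),
    w.state i t (k + 1) = w.mixed i t k + α t • (w.v i t k - w.mixed i t k)
  x_succ : ∀ i, ∀ t ∈ Set.Icc 1 T, w.x i (t + 1) = w.state i t (K t + 1)

/-- The global loss of round `t`. -/
def globalLoss {n d : ℕ} (f : Fin n → ℕ → EuclideanSpace ℝ (Fin d) → ℝ) (t : ℕ)
    (x : EuclideanSpace ℝ (Fin d)) : ℝ :=
  ∑ i, f i t x

/-- The dynamic regret of a decision sequence `x` against the comparators `xstar`. -/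
def dynamicRegret {n d : ℕ} (f : Fin n → ℕ → EuclideanSpace ℝ (Fin d) → ℝ) (T : ℕ)
    (x xstar : ℕ → EuclideanSpace ℝ (Fin d)) : ℝ :=
  ∑ t ∈ Finset.Icc 1 T, globalLoss f t (x t) - ∑ t ∈ Finset.Icc 1 T, globalLoss f t (xstar t)

/-- The function variation `H_T`. For a nonempty compact `X` and continuous losses the suprema
are maxima. -/
def functionVariation {n d : ℕ} (X : Set (EuclideanSpace ℝ (Fin d)))
    (f : Fin n → ℕ → EuclideanSpace ℝ (Fin d) → ℝ) (T : ℕ) : ℝ :=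
  ∑ t ∈ Finset.Ico 1 T, ⨆ i : Fin n, ⨆ x : X, |f i (t + 1) x - f i t x|

/-- The average of the initial points. -/
def average {n d : ℕ} (x₁ : Fin n → EuclideanSpace ℝ (Fin d)) : EuclideanSpace ℝ (Fin d) :=
  (1 / (n : ℝ)) • ∑ i, x₁ i

/-- The mixing rate `σ₁`. -/
def sigma (n : ℕ) (ζ : ℝ) : ℝ := 1 - ζ / (4 * (n : ℝ) ^ 2)

/-- The mixing constant `Γ₁`. -/
def Gam (n : ℕ) (ζ : ℝ) : ℝ := (1 - ζ / (4 * (n : ℝ) ^ 2))⁻¹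

/-- The constant `D₁`. -/
def D₁ {n d : ℕ} (ζ M L GX : ℝ) (x₁ : Fin n → EuclideanSpace ℝ (Fin d)) : ℝ :=
  (2 * n * Gam n ζ * GX / (1 - sigma n ζ) + GX)
      * (n * M + n * Gam n ζ / (1 - sigma n ζ) * ∑ j, (‖x₁ j‖ + M))
    + (n : ℝ) ^ 2 * Gam n ζ * L / (1 - sigma n ζ)

/-- The constant `D₂`. -/
def D₂ (n : ℕ) (ζ M GX : ℝ) : ℝ :=
  2 * (n : ℝ) ^ 2 * Gam n ζ * GX * M / (1 - sigma n ζ)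
      * (n * Gam n ζ / (1 - sigma n ζ) + 3)
    + 2 * n * M * GX

/-- The constant `E₁`; `K₁` is the number of inner iterations of the first round. -/
def E₁ {n d : ℕ} (ζ M L ρ : ℝ) (K₁ : ℕ) (x₁ : Fin n → EuclideanSpace ℝ (Fin d)) : ℝ :=
  (n : ℝ) ^ 2 * L * Gam n ζ / (1 - sigma n ζ ^ K₁) * ∑ i, ‖x₁ i‖
    + n * L * ∑ i, ‖x₁ i - average x₁‖
    + n * L * M * (1 - Real.exp (-(1 / ρ)))⁻¹

/-- The constant `E₂`. -/
def E₂ (n : ℕ) (ρ : ℝ) : ℝ := 2 * n * (1 - Real.exp (-(1 / ρ)))⁻¹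

/-- The constant `E₃`. -/
def E₃ {n d : ℕ} (ζ M L GX ρ : ℝ) (K₁ : ℕ) (x₁ : Fin n → EuclideanSpace ℝ (Fin d)) : ℝ :=
  2 * M * (1 / ρ * D₁ ζ M L GX x₁ + 1 / ρ ^ 2 * D₂ n ζ M GX) * (1 - Real.exp (-(1 / ρ)))⁻¹
    + n * GX * M ^ 2 / (2 * ρ) * (1 - Real.exp (-(1 / ρ)))⁻¹
    + (n : ℝ) ^ 2 * L * M / ρ
      * (n * Gam n ζ / (sigma n ζ * (1 - sigma n ζ) * (1 - sigma n ζ ^ K₁)) + 2)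

end DOMFW

end

/-! Lipschitz continuity splits the regret of agent `j` into `n * L` times the total distance of the
agents from consensus and the total suboptimality of the network averages. From round to round each
of the two sequences contracts up to a source term, and `a (t + 1) ≤ q * a t + b t` sums to `(1 - q)
* ∑ a ≤ a 1 + ∑ b` (`sum_le_of_succ_le`), which is the shape of the bound.

Consensus: averaging with doubly stochastic weights lowers the sum of squares by exactly the local
variances (`sum_sq_mix`). These bound differences along edges, and strong connectivity turns that
into a bound on all differences, so a single mixing contracts the spread by σ₁
(`IsNetwork.spread_mix_le`); no products of matrices are needed. A Frank–Wolfe step adds at most `α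
* (n * M)`.

Suboptimality: gradient tracking keeps the average of the estimates equal to the average of the
local gradients. Hence `n` times an estimate differs from the global gradient at the network average
only through the spreads of states and estimates, whose sum over a round is bounded because `K t * α
t = 1 / ρ`. The average thus performs an inexact Frank–Wolfe method: a round multiplies its
suboptimality by at most `exp (-(1 / ρ))` and adds a multiple of `1 / K t`, and changing the loss
costs the function variation.

Gradients: smoothness is assumed only between points of `X`, so it controls only the gradient
component along `vectorSpan ℝ X`. That component is `GX`-Lipschitz on `X`
(`IsTangentGradient.norm_sub_le`), even if `X` has empty interior, and projecting onto it does not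
affect the linear oracle. -/

namespace DOMFW

/-! ### Families of vectors: norm, average and distance from consensus. -/

variable {n d : ℕ}

/-- The Euclidean norm of a family of vectors. -/
noncomputable def l2 (x : Fin n → EuclideanSpace ℝ (Fin d)) : ℝ := ‖WithLp.toLp 2 x‖

/-- The family of weighted averages with weights in the rows of `A`. -/
def mix (A : Matrix (Fin n) (Fin n) ℝ) (x : Fin n → EuclideanSpace ℝ (Fin d)) :
    Fin n → EuclideanSpace ℝ (Fin d) := fun i => ∑ j, A i j • x j

/-- The deviations of a family from its average. -/
noncomputable def center (x : Fin n → EuclideanSpace ℝ (Fin d)) :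
    Fin n → EuclideanSpace ℝ (Fin d) := fun i => x i - average x

/-- The Euclidean distance of a family from consensus. -/
noncomputable def spread (x : Fin n → EuclideanSpace ℝ (Fin d)) : ℝ := l2 (center x)

section l2

variable (x y : Fin n → EuclideanSpace ℝ (Fin d))

theorem l2_nonneg : 0 ≤ l2 x := norm_nonneg _

theorem l2_sq : l2 x ^ 2 = ∑ i, ‖x i‖ ^ 2 := by
  simp [l2, PiLp.norm_sq_eq_of_L2]

theorem l2_add_le : l2 (x + y) ≤ l2 x + l2 y := by
  simpa [l2, WithLp.toLp_add] using norm_add_le (WithLp.toLp 2 x) (WithLp.toLp 2 y)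

theorem l2_sub_le : l2 (x - y) ≤ l2 x + l2 y := by
  simpa [l2, WithLp.toLp_sub] using norm_sub_le (WithLp.toLp 2 x) (WithLp.toLp 2 y)

theorem l2_smul (c : ℝ) : l2 (c • x) = |c| * l2 x := by
  simp [l2, WithLp.toLp_smul, norm_smul]

theorem norm_le_l2 (i : Fin n) : ‖x i‖ ≤ l2 x :=
  PiLp.norm_apply_le (WithLp.toLp 2 x) i

theorem l2_le_sum : l2 x ≤ ∑ i, ‖x i‖ := by
  refine abs_le_of_sq_le_sq' ?_ (Finset.sum_nonneg fun i _ => norm_nonneg _) |>.2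
  rw [l2_sq]
  exact Finset.sum_sq_le_sq_sum_of_nonneg fun i _ => norm_nonneg _

theorem sum_le_l2 : ∑ i, ‖x i‖ ≤ n * l2 x := by
  simpa using Finset.sum_le_sum fun i (_ : i ∈ Finset.univ) => norm_le_l2 x i

variable {x y}

theorem l2_le_of_forall_le {c : ℝ} (h : ∀ i, ‖x i‖ ≤ c) : l2 x ≤ n * c :=
  (l2_le_sum x).trans (by simpa using Finset.sum_le_sum fun i (_ : i ∈ Finset.univ) => h i)

theorem l2_mono (h : ∀ i, ‖x i‖ ≤ ‖y i‖) : l2 x ≤ l2 y := by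
  refine abs_le_of_sq_le_sq' ?_ (l2_nonneg y) |>.2
  rw [l2_sq, l2_sq]
  exact Finset.sum_le_sum fun i _ => by gcongr; exact h i

end l2

section average

variable (x y : Fin n → EuclideanSpace ℝ (Fin d))

theorem average_add : average (x + y) = average x + average y := by
  simp [average, Finset.sum_add_distrib]

theorem average_sub : average (x - y) = average x - average y := by
  simp [average, Finset.sum_sub_distrib, smul_sub]

theorem average_smul (c : ℝ) : average (c • x) = c • average x := by
  simp only [average, Pi.smul_apply, ← Finset.smul_sum]
  rw [smul_comm]

theorem center_add : center (x + y) = center x + center y := by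
  funext i; simp only [center, average_add, Pi.add_apply]; abel

theorem center_smul (c : ℝ) : center (c • x) = c • center x := by
  funext i; simp [center, average_smul, smul_sub]

theorem spread_nonneg : 0 ≤ spread x := l2_nonneg _

theorem spread_add_le : spread (x + y) ≤ spread x + spread y := by
  simpa [spread, center_add] using l2_add_le (center x) (center y)

theorem spread_smul (c : ℝ) : spread (c • x) = |c| * spread x := by
  simp [spread, center_smul, l2_smul]

theorem sum_eq_smul_average (hn : 0 < n) : ∑ i, x i = (n : ℝ) • average x := by
  have : (n : ℝ) ≠ 0 := by positivity
  simp [average, smul_smul, this]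

theorem average_center (hn : 0 < n) : average (center x) = 0 := by
  have : (n : ℝ) ≠ 0 := by positivity
  simp [average, center, Finset.sum_sub_distrib, ← Nat.cast_smul_eq_nsmul ℝ, smul_smul, this]

theorem spread_le_l2 (hn : 0 < n) : spread x ≤ l2 x := by
  refine abs_le_of_sq_le_sq' ?_ (l2_nonneg x) |>.2
  rw [spread, l2_sq, l2_sq]
  -- Pythagoras: the deviations sum to zero, so the cross terms vanish.
  have h : ∑ i, ‖x i‖ ^ 2 = ∑ i, ‖center x i‖ ^ 2 + n * ‖average x‖ ^ 2 := by
    have h1 : ∀ i, ‖x i‖ ^ 2 = ‖center x i‖ ^ 2 + 2 * inner ℝ (center x i) (average x)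
        + ‖average x‖ ^ 2 := fun i => by
      rw [← norm_add_sq_real, center, sub_add_cancel]
    simp_rw [h1, Finset.sum_add_distrib, ← Finset.mul_sum, ← sum_inner]
    rw [sum_eq_smul_average _ hn, average_center _ hn]
    simp
  rw [h]
  nlinarith [mul_nonneg (Nat.cast_nonneg (α := ℝ) n) (sq_nonneg ‖average x‖)]

theorem average_mem {X : Set (EuclideanSpace ℝ (Fin d))} (hX : Convex ℝ X) (hn : 0 < n)
    (h : ∀ i, x i ∈ X) : average x ∈ X := by
  rw [average, Finset.smul_sum]
  exact hX.sum_mem (fun _ _ => by positivity) (by simp; field_simp) fun i _ => h i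

end average

/-! ### Contraction of the spread by one doubly stochastic averaging. -/

section mix

variable {ζ : ℝ} {G : Digraph (Fin n)} {A : Matrix (Fin n) (Fin n) ℝ}
variable (x y : Fin n → EuclideanSpace ℝ (Fin d))

theorem mix_add : mix A (x + y) = mix A x + mix A y := by
  funext i; simp [mix, Finset.sum_add_distrib]

theorem mix_smul (c : ℝ) : mix A (c • x) = c • mix A x := by
  funext i; simp [mix, Finset.smul_sum, smul_comm c]

theorem average_mix (hA : A ∈ doublyStochastic ℝ (Fin n)) : average (mix A x) = average x := by
  rw [average, average]
  congr 1
  simp only [mix]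
  rw [Finset.sum_comm]
  simp [← Finset.sum_smul, sum_col_of_mem_doublyStochastic hA]

theorem mix_const (hA : A ∈ doublyStochastic ℝ (Fin n)) (c : EuclideanSpace ℝ (Fin d)) :
    mix A (fun _ => c) = fun _ => c := by
  funext i
  simp [mix, ← Finset.sum_smul, sum_row_of_mem_doublyStochastic hA]

theorem mix_sub : mix A (x - y) = mix A x - mix A y := by
  funext i; simp [mix, Finset.sum_sub_distrib, smul_sub]

theorem center_mix (hA : A ∈ doublyStochastic ℝ (Fin n)) : center (mix A x) = mix A (center x) := by
  have : center x = x - fun _ => average x := rfl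
  rw [this, mix_sub, mix_const hA]
  funext i
  simp [center, average_mix x hA]

theorem mix_mem {X : Set (EuclideanSpace ℝ (Fin d))} (hX : Convex ℝ X)
    (hA : A ∈ doublyStochastic ℝ (Fin n)) (h : ∀ i, x i ∈ X) (i : Fin n) : mix A x i ∈ X :=
  hX.sum_mem (fun _ _ => nonneg_of_mem_doublyStochastic hA)
    (sum_row_of_mem_doublyStochastic hA i) fun j _ => h j

/-- Averaging with doubly stochastic weights loses exactly the local variances. -/
theorem sum_sq_mix (hA : A ∈ doublyStochastic ℝ (Fin n)) :
    ∑ j, ‖x j‖ ^ 2 = ∑ i, ‖mix A x i‖ ^ 2 + ∑ i, ∑ j, A i j * ‖x j - mix A x i‖ ^ 2 := by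
  have h1 : ∀ i, ∑ j, A i j * ‖x j - mix A x i‖ ^ 2
      = ∑ j, A i j * ‖x j‖ ^ 2 - ‖mix A x i‖ ^ 2 := by
    intro i
    have h2 : ∑ j, A i j * inner ℝ (x j) (mix A x i) = ‖mix A x i‖ ^ 2 := by
      rw [← real_inner_self_eq_norm_sq]
      nth_rewrite 2 [mix]
      simp [sum_inner, inner_smul_left]
    have h3 : ∑ j, A i j * ‖mix A x i‖ ^ 2 = ‖mix A x i‖ ^ 2 := by
      rw [← Finset.sum_mul, sum_row_of_mem_doublyStochastic hA, one_mul]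
    simp_rw [norm_sub_sq_real, mul_add, mul_sub, Finset.sum_add_distrib, Finset.sum_sub_distrib,
      h3, mul_left_comm _ (2 : ℝ), ← Finset.mul_sum, h2]
    ring
  simp_rw [h1, Finset.sum_sub_distrib]
  rw [Finset.sum_comm (f := fun i j => A i j * ‖x j‖ ^ 2)]
  simp [← Finset.sum_mul, sum_col_of_mem_doublyStochastic hA]

theorem l2_mix_le (hA : A ∈ doublyStochastic ℝ (Fin n)) : l2 (mix A x) ≤ l2 x := by
  refine abs_le_of_sq_le_sq' ?_ (l2_nonneg x) |>.2
  rw [l2_sq, l2_sq, sum_sq_mix x hA]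
  have : 0 ≤ ∑ i, ∑ j, A i j * ‖x j - mix A x i‖ ^ 2 :=
    Finset.sum_nonneg fun i _ => Finset.sum_nonneg fun j _ =>
      mul_nonneg (nonneg_of_mem_doublyStochastic hA) (sq_nonneg _)
  linarith

theorem l2_mix_sub_le (hA : A ∈ doublyStochastic ℝ (Fin n)) :
    l2 (mix A x - x) ≤ 2 * spread x := by
  have : mix A x - x = mix A (center x) - center x := by
    rw [← center_mix x hA]
    funext i
    simp [center, average_mix x hA]
  rw [this]
  linarith [l2_sub_le (mix A (center x)) (center x), l2_mix_le (center x) hA, spread.eq_1 x]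

/-- In a strongly connected graph, increments bounded along edges by a charge on the head of the
edge bound all differences by the total charge. -/
theorem StronglyConnected.norm_sub_le (hG : StronglyConnected G) {c : Fin n → ℝ}
    (hc : ∀ i, 0 ≤ c i) (h : ∀ j i, G.Adj j i → ‖x i - x j‖ ≤ c i) (i₀ i : Fin n) :
    ‖x i - x i₀‖ ≤ ∑ s, c s := by
  classical
  -- Maximality replaces the choice of simple paths: a vertex outside `R` reached by an edge from
  -- `R` could be added, its own charge paying for that edge. Each vertex is charged only once.
  obtain ⟨R, ⟨hi₀, hR⟩, hmax⟩ :=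
    (Set.toFinite {R : Finset (Fin n) |
      i₀ ∈ R ∧ ∀ k ∈ R, ‖x k - x i₀‖ ≤ ∑ s ∈ R, c s}).exists_maximal ⟨{i₀}, by simp [hc]⟩
  have hall : ∀ k, k ∈ R := by
    intro k
    induction hG i₀ k with
    | refl => exact hi₀
    | @tail j k _ hjk hj =>
      by_contra hk
      have hins : ∀ l ∈ insert k R, ‖x l - x i₀‖ ≤ ∑ s ∈ insert k R, c s := by
        intro l hl
        rw [Finset.sum_insert hk]
        rcases Finset.mem_insert.1 hl with rfl | hl
        · calc ‖x l - x i₀‖ = ‖(x l - x j) + (x j - x i₀)‖ := by congr 1; abel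
            _ ≤ _ := (norm_add_le _ _).trans (add_le_add (h j l hjk) (hR j hj))
        · linarith [hR l hl, hc k]
      exact hk (hmax ⟨Finset.mem_insert_of_mem hi₀, hins⟩ (Finset.subset_insert k R)
        (Finset.mem_insert_self k R))
  simpa [Finset.eq_univ_iff_forall.2 hall] using hR i (hall i)

namespace IsNetwork

theorem mix_eq (hA : IsNetwork ζ G A) (i : Fin n) :
    mix A x i = ∑ j ∈ inNeighbors G i, A i j • x j :=
  (Finset.sum_subset (Finset.subset_univ _) fun j _ hj => by
    rw [hA.weight_zero i j hj, zero_smul]).symm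

theorem zeta_le_one (hA : IsNetwork ζ G A) (i : Fin n) : ζ ≤ 1 := by
  have hi : i ∈ inNeighbors G i := by simp [inNeighbors]
  refine (hA.weight_lower i i (hA.weight_pos i i hi)).trans ?_
  rw [← sum_row_of_mem_doublyStochastic hA.doubly i]
  exact Finset.single_le_sum (f := fun j => A i j)
    (fun j _ => nonneg_of_mem_doublyStochastic hA.doubly) (Finset.mem_univ i)

/-- Both ends of an edge into `i` have weight at least `ζ` in row `i`, the end `i` by its self-loop,
so the local variance at `i` bounds the distance of each from the weighted mean. -/
theorem norm_sub_sq_le (hζ : 0 < ζ) (hA : IsNetwork ζ G A) {i j : Fin n} (hij : G.Adj j i) :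
    ‖x i - x j‖ ^ 2 ≤ 2 / ζ * ∑ k, A i k * ‖x k - mix A x i‖ ^ 2 := by
  have hnn : ∀ k, 0 ≤ A i k * ‖x k - mix A x i‖ ^ 2 := fun k =>
    mul_nonneg (nonneg_of_mem_doublyStochastic hA.doubly) (sq_nonneg _)
  rw [div_mul_eq_mul_div, le_div_iff₀ hζ]
  rcases eq_or_ne i j with rfl | hne
  · simpa using Finset.sum_nonneg fun k _ => hnn k
  have hpair : A i i * ‖x i - mix A x i‖ ^ 2 + A i j * ‖x j - mix A x i‖ ^ 2
      ≤ ∑ k, A i k * ‖x k - mix A x i‖ ^ 2 := by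
    rw [← Finset.sum_pair (f := fun k => A i k * ‖x k - mix A x i‖ ^ 2) hne]
    exact Finset.sum_le_univ_sum_of_nonneg hnn
  have hi : ζ ≤ A i i := hA.weight_lower i i (hA.weight_pos i i (by simp [inNeighbors]))
  have hj : ζ ≤ A i j := hA.weight_lower i j (hA.weight_pos i j (by simp [inNeighbors, hij]))
  have htri : ‖x i - x j‖ ≤ ‖x i - mix A x i‖ + ‖x j - mix A x i‖ := by
    rw [← sub_sub_sub_cancel_right (x i) (x j) (mix A x i)]
    exact _root_.norm_sub_le _ _
  have hsq : ‖x i - x j‖ ^ 2 ≤ 2 * (‖x i - mix A x i‖ ^ 2 + ‖x j - mix A x i‖ ^ 2) := by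
    nlinarith [norm_nonneg (x i - x j), sq_nonneg (‖x i - mix A x i‖ - ‖x j - mix A x i‖)]
  nlinarith [mul_le_mul_of_nonneg_right hi (sq_nonneg ‖x i - mix A x i‖),
    mul_le_mul_of_nonneg_right hj (sq_nonneg ‖x j - mix A x i‖)]

/-- The loss of squared spread is the total local variance. Charging each vertex the root of its
scaled local variance bounds every difference, hence every deviation, by the total charge;
Cauchy–Schwarz gives one factor `n` and summing over agents the other. -/
theorem sq_spread_le (hn : 0 < n) (hζ : 0 < ζ) (hA : IsNetwork ζ G A) :
    spread x ^ 2 ≤ 2 * n ^ 2 / ζ * (spread x ^ 2 - spread (mix A x) ^ 2) := by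
  set y := center x with hy
  set W : Fin n → ℝ := fun i => ∑ k, A i k * ‖y k - mix A y i‖ ^ 2 with hW
  have hWnn : ∀ i, 0 ≤ W i := fun i => Finset.sum_nonneg fun k _ =>
    mul_nonneg (nonneg_of_mem_doublyStochastic hA.doubly) (sq_nonneg _)
  have hloss : spread x ^ 2 - spread (mix A x) ^ 2 = ∑ i, W i := by
    rw [spread, spread, center_mix x hA.doubly, l2_sq, l2_sq, sum_sq_mix (center x) hA.doubly]
    ring
  set c : Fin n → ℝ := fun i => √(2 / ζ * W i) with hc
  have hc2 : ∀ i, c i ^ 2 = 2 / ζ * W i := fun i => Real.sq_sqrt (by have := hWnn i; positivity)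
  have hdiam : ∀ i k, ‖y i - y k‖ ≤ ∑ s, c s := fun i k =>
    hA.connected.norm_sub_le y (fun i => Real.sqrt_nonneg _)
      (fun j i hij => Real.le_sqrt_of_sq_le (norm_sub_sq_le y hζ hA hij)) k i
  have hn' : (0 : ℝ) < n := by positivity
  have hbound : ∀ i, ‖y i‖ ≤ ∑ s, c s := by
    intro i
    have h1 : (n : ℝ) • y i = ∑ k, (y i - y k) := by
      rw [Finset.sum_sub_distrib, sum_eq_smul_average y hn, hy, average_center x hn]
      simp [Nat.cast_smul_eq_nsmul]
    have h2 : (n : ℝ) * ‖y i‖ ≤ n * ∑ s, c s := by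
      calc (n : ℝ) * ‖y i‖ = ‖(n : ℝ) • y i‖ := by simp [norm_smul]
        _ ≤ ∑ k, ‖y i - y k‖ := by rw [h1]; exact norm_sum_le _ _
        _ ≤ ∑ _k : Fin n, ∑ s, c s := Finset.sum_le_sum fun k _ => hdiam i k
        _ = _ := by simp
    exact le_of_mul_le_mul_left h2 hn'
  have hcs : (∑ s, c s) ^ 2 ≤ n * (2 / ζ * ∑ i, W i) := by
    have := sq_sum_le_card_mul_sum_sq (s := Finset.univ) (f := c)
    simpa [hc2, Finset.mul_sum] using this
  rw [hloss]
  calc spread x ^ 2 = ∑ i, ‖y i‖ ^ 2 := by rw [spread, l2_sq]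
    _ ≤ ∑ _i : Fin n, (∑ s, c s) ^ 2 := Finset.sum_le_sum fun i _ => by
        gcongr; exact hbound i
    _ = n * (∑ s, c s) ^ 2 := by simp
    _ ≤ n * (n * (2 / ζ * ∑ i, W i)) := by gcongr
    _ = _ := by ring

theorem sigma_pos (hA : IsNetwork ζ G A) (i : Fin n) : 0 < sigma n ζ := by
  have h1 := hA.zeta_le_one i
  have hn : (1 : ℝ) ≤ n := by exact_mod_cast i.pos
  rw [sigma, sub_pos, div_lt_one (by positivity)]
  nlinarith

theorem spread_mix_le (hζ : 0 < ζ) (hA : IsNetwork ζ G A) :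
    spread (mix A x) ≤ sigma n ζ * spread x := by
  rcases Nat.eq_zero_or_pos n with rfl | hn
  · simp [spread, l2, PiLp.norm_eq_of_L2]
  have hs := hA.sigma_pos ⟨0, hn⟩
  refine abs_le_of_sq_le_sq' ?_ (mul_nonneg hs.le (spread_nonneg x)) |>.2
  have h := sq_spread_le x hn hζ hA
  have hn' : (0 : ℝ) < n := by positivity
  rw [div_mul_eq_mul_div, le_div_iff₀ hζ] at h
  have hz : ζ = (1 - sigma n ζ) * (4 * n ^ 2) := by rw [sigma]; field_simp; ring
  generalize sigma n ζ = s at *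
  have h2 : 2 * (n : ℝ) ^ 2 * spread (mix A x) ^ 2
      ≤ 2 * (n : ℝ) ^ 2 * ((2 * s - 1) * spread x ^ 2) := by
    rw [hz] at h; linarith
  have h3 := le_of_mul_le_mul_left h2 (by positivity)
  -- The squared spread shrinks by `1 - ζ / (2 * n ^ 2) = 2 * s - 1`, and `2 * s - 1 ≤ s ^ 2`.
  nlinarith [mul_nonneg (sq_nonneg (s - 1)) (sq_nonneg (spread x))]

end IsNetwork

end mix

/-! ### Tangential gradients of smooth convex functions on a convex set. -/

/-- `g` is the component along the directions of `X` of the gradient of a convex function `f`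
which is `GX`-smooth on `X`. -/
structure IsTangentGradient {E : Type*} [NormedAddCommGroup E] [InnerProductSpace ℝ E]
    (X : Set E) (GX : ℝ) (f : E → ℝ) (g : E → E) : Prop where
  mem : ∀ z ∈ X, g z ∈ vectorSpan ℝ X
  support : ∀ x ∈ X, ∀ z ∈ X, f z + inner ℝ (g z) (x - z) ≤ f x
  smooth : ∀ x ∈ X, ∀ z ∈ X, f x ≤ f z + inner ℝ (g z) (x - z) + GX / 2 * ‖x - z‖ ^ 2

section

variable {E : Type*} [NormedAddCommGroup E] [InnerProductSpace ℝ E]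

theorem exists_norm_le_inner_eq {V : Submodule ℝ E} {v : E} (hv : v ∈ V) {η : ℝ} (hη : 0 ≤ η) :
    ∃ u ∈ V, ‖u‖ ≤ η ∧ inner ℝ v u = η * ‖v‖ := by
  -- For `v = 0` division by zero makes the witness `0`, which still works.
  refine ⟨(η / ‖v‖) • v, V.smul_mem _ hv, ?_, ?_⟩
  · rw [norm_smul, norm_div, norm_norm, Real.norm_of_nonneg hη]
    rcases eq_or_ne ‖v‖ 0 with h | h
    · simpa [h]
    · rw [div_mul_cancel₀ _ h]
  · rcases eq_or_ne v 0 with rfl | h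
    · simp
    · have : ‖v‖ ≠ 0 := norm_ne_zero_iff.2 h
      rw [inner_smul_right, real_inner_self_eq_norm_sq]
      field_simp

theorem sub_mem_vectorSpan {X : Set E} {x z : E} (hx : x ∈ X) (hz : z ∈ X) :
    x - z ∈ vectorSpan ℝ X := by
  simpa using vsub_mem_vectorSpan ℝ hx hz

/-- A nonempty convex set contains a relative ball. -/
theorem exists_relative_ball [FiniteDimensional ℝ E] {X : Set E} (hX : Convex ℝ X)
    (hne : X.Nonempty) :
    ∃ c ∈ X, ∃ ε : ℝ, 0 < ε ∧ ∀ u ∈ vectorSpan ℝ X, ‖u‖ ≤ ε → c + u ∈ X := by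
  obtain ⟨c, hc⟩ := hne.intrinsicInterior hX
  obtain ⟨y, hy, rfl⟩ := mem_intrinsicInterior.1 hc
  obtain ⟨ε, hε, hball⟩ := Metric.isOpen_iff.1 isOpen_interior y hy
  have hyX : (y : E) ∈ X := intrinsicInterior_subset hc
  -- Half the radius, so that the closed ball lies in the open one.
  refine ⟨y, hyX, ε / 2, by positivity, fun u hu hle => ?_⟩
  have hmem : (y : E) + u ∈ affineSpan ℝ X := by
    have := AffineSubspace.vadd_mem_of_mem_direction (s := affineSpan ℝ X) (v := u)
      (by rwa [direction_affineSpan]) y.2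
    rwa [vadd_eq_add, add_comm] at this
  have : (⟨(y : E) + u, hmem⟩ : affineSpan ℝ X) ∈ Metric.ball y ε := by
    rw [Metric.mem_ball, Subtype.dist_eq, dist_eq_norm]
    simp only [add_sub_cancel_left]
    linarith
  have hsub := interior_subset (hball this)
  exact hsub

theorem le_of_forall_le_add_mul {a b C : ℝ} (h : ∀ s ∈ Set.Ioc (0 : ℝ) 1, a ≤ b + C * s) :
    a ≤ b := by
  refine ge_of_tendsto (f := fun s => b + C * s) (x := nhdsWithin (0 : ℝ) (Set.Ioi 0)) ?_ ?_
  · have : Filter.Tendsto (fun s : ℝ => b + C * s) (nhds 0) (nhds (b + C * 0)) :=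
      Continuous.tendsto (by fun_prop) 0
    simpa using this.mono_left nhdsWithin_le_nhds
  · filter_upwards [Ioc_mem_nhdsGT (zero_lt_one' ℝ)] with s hs using h s hs

/-- The points of `X` surrounded by a relative ball of radius `η`. -/
def relativeCore (X : Set E) (η : ℝ) : Set E :=
  {x | ∀ u ∈ vectorSpan ℝ X, ‖u‖ ≤ η → x + u ∈ X}

theorem mem_of_mem_relativeCore {X : Set E} {η : ℝ} (hη : 0 ≤ η) {x : E}
    (h : x ∈ relativeCore X η) : x ∈ X := by
  simpa using h 0 (zero_mem _) (by simpa)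

theorem convex_relativeCore {X : Set E} (hX : Convex ℝ X) (η : ℝ) :
    Convex ℝ (relativeCore X η) := by
  intro x hx z hz a b ha hb hab u hu hle
  have := hX (hx u hu hle) (hz u hu hle) ha hb hab
  rwa [smul_add, smul_add, add_add_add_comm, ← add_smul, hab, one_smul] at this

/-- The homothety with centre `z` and ratio `1 - s` towards `c` has the convex combination `(1 - s)
z + s c` as value, and it carries the relative ball around `c` to one of radius `s * ε`. Thus every
point of `X` is a limit of points of relative cores. -/
theorem homothety_mem_relativeCore {X : Set E} (hX : Convex ℝ X) {c z : E} {ε s : ℝ}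
    (hc : c ∈ relativeCore X ε) (hz : z ∈ X) (hs : s ∈ Set.Ioc (0 : ℝ) 1) :
    z + s • (c - z) ∈ relativeCore X (s * ε) := by
  intro u hu hle
  have h1 : c + s⁻¹ • u ∈ X := hc _ (Submodule.smul_mem _ _ hu) (by
    rw [norm_smul, norm_inv, Real.norm_of_nonneg hs.1.le]
    exact inv_mul_le_of_le_mul₀ hs.1.le
      (nonneg_of_mul_nonneg_right ((norm_nonneg u).trans hle) hs.1) hle)
  have := hX hz h1 (sub_nonneg.2 hs.2) hs.1.le (by ring)
  convert this using 1
  rw [smul_add, smul_smul, mul_inv_cancel₀ hs.1.ne', one_smul, smul_sub, sub_smul, one_smul]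
  abel

namespace IsTangentGradient

variable {X : Set E} {GX : ℝ} {f : E → ℝ} {g : E → E}

/-- At `w`, `f` lies above its tangent at `z` and below its parabola at `x`, while `f z` lies above
the tangent at `x`. -/
theorem inner_sub_le (h : IsTangentGradient X GX f g) {x z w : E} (hx : x ∈ X) (hz : z ∈ X)
    (hw : w ∈ X) : inner ℝ (g z - g x) (w - z) ≤ GX / 2 * ‖w - x‖ ^ 2 := by
  have h1 := h.support w hw z hz
  have h2 := h.smooth w hw x hx
  have h3 := h.support z hz x hx
  have h4 : inner ℝ (g x) (w - x) = inner ℝ (g x) (w - z) + inner ℝ (g x) (z - x) := by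
    rw [← inner_add_right, sub_add_sub_cancel]
  rw [inner_sub_left]
  linarith

theorem norm_sub_mul_le (h : IsTangentGradient X GX f g) (hGX : 0 ≤ GX) {x z : E} {η : ℝ}
    (hη : 0 ≤ η) (hx : x ∈ X) (hz : z ∈ relativeCore X η) :
    η * ‖g z - g x‖ ≤ GX / 2 * (‖z - x‖ + η) ^ 2 := by
  have hzX := mem_of_mem_relativeCore hη hz
  obtain ⟨u, hu, hun, hui⟩ := exists_norm_le_inner_eq
    (Submodule.sub_mem _ (h.mem z hzX) (h.mem x hx)) hη
  have h1 := h.inner_sub_le hx hzX (hz u hu hun)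
  rw [add_sub_cancel_left, hui] at h1
  refine h1.trans ?_
  gcongr
  calc ‖z + u - x‖ = ‖(z - x) + u‖ := by congr 1; abel
    _ ≤ _ := (norm_add_le _ _).trans (by gcongr)

theorem norm_sub_le_of_near (h : IsTangentGradient X GX f g) (hGX : 0 ≤ GX) {x z : E} {η : ℝ}
    (hx : x ∈ relativeCore X η) (hz : z ∈ relativeCore X η) (hxz : ‖x - z‖ ≤ η) :
    ‖g x - g z‖ ≤ GX * ‖x - z‖ := by
  rcases eq_or_ne x z with rfl | hne
  · simp
  have hη : 0 ≤ η := (norm_nonneg _).trans hxz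
  have hxX := mem_of_mem_relativeCore hη hx
  have hzX := mem_of_mem_relativeCore hη hz
  have hr : 0 < ‖x - z‖ := norm_pos_iff.2 (sub_ne_zero.2 hne)
  obtain ⟨p, hp, hpn, hpi⟩ := exists_norm_le_inner_eq
    (Submodule.sub_mem _ (h.mem z hzX) (h.mem x hxX)) hr.le
  have hxp : x + p ∈ X := hx p hp (hpn.trans hxz)
  have hzp : z - p ∈ X := by
    simpa [sub_eq_add_neg] using hz (-p) (neg_mem hp) (by simpa using hpn.trans hxz)
  -- With `Δ = g z - g x`, comparing parabola and tangent at `x + p` and at `z - p` and adding gives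
  -- `⟨Δ, x - z⟩ + 2⟨Δ, p⟩ ≤ GX * ‖p‖ ^ 2`. As `p` points along `Δ`, Cauchy–Schwarz on the first
  -- term leaves the sharp constant `GX`.
  have h1 := h.smooth _ hxp x hxX
  have h2 := h.support _ hxp z hzX
  have h3 := h.smooth _ hzp z hzX
  have h4 := h.support _ hzp x hxX
  have hcs := abs_le.1 (abs_real_inner_le_norm (g z - g x) (x - z)) |>.1
  have e1 : x + p - z = (x - z) + p := by abel
  have e2 : z - p - x = -((x - z) + p) := by abel
  have e3 : z - p - z = -p := by abel
  rw [add_sub_cancel_left] at h1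
  rw [e1, inner_add_right] at h2
  rw [e3, inner_neg_right, norm_neg] at h3
  rw [e2, inner_neg_right, inner_add_right] at h4
  rw [inner_sub_left] at hpi hcs
  have hp2 : GX * ‖p‖ ^ 2 ≤ GX * ‖x - z‖ ^ 2 := by gcongr
  rw [norm_sub_rev (g x)]
  nlinarith

/-- The core is convex, so the segment can be cut into pieces shorter than `η`. The local bounds add
up with a constant independent of `η`. -/
theorem norm_sub_le_of_relativeCore (h : IsTangentGradient X GX f g) (hGX : 0 ≤ GX)
    (hX : Convex ℝ X) {x z : E} {η : ℝ} (hη : 0 < η) (hx : x ∈ relativeCore X η)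
    (hz : z ∈ relativeCore X η) : ‖g x - g z‖ ≤ GX * ‖x - z‖ := by
  obtain ⟨N, hN⟩ := exists_nat_gt (‖x - z‖ / η)
  have hN0 : (0 : ℝ) < N := lt_of_le_of_lt (by positivity) hN
  rw [div_lt_iff₀ hη] at hN
  set y : ℕ → E := fun m => z + ((m : ℝ) / N) • (x - z) with hy
  have hmem : ∀ m ≤ N, y m ∈ relativeCore X η := fun m hm =>
    (convex_relativeCore hX η).add_smul_sub_mem hz hx ⟨by positivity, by
      rw [div_le_one hN0]; exact_mod_cast hm⟩
  have hstep : ∀ m, ‖y m - y (m + 1)‖ = ‖x - z‖ / N := fun m => by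
    have : y m - y (m + 1) = (-(1 / N : ℝ)) • (x - z) := by
      simp only [hy, add_sub_add_left_eq_sub, ← sub_smul]
      congr 1
      push_cast
      ring
    rw [this, norm_smul, norm_neg, Real.norm_of_nonneg (by positivity)]
    ring
  have h0 : y 0 = z := by simp [hy]
  have hNx : y N = x := by simp [hy, hN0.ne']
  have hdist := dist_le_range_sum_of_dist_le (f := fun m => g (y m)) (n := N)
    (d := fun _ => GX * (‖x - z‖ / N)) fun {m} hm => by
      rw [dist_eq_norm, ← hstep m]
      refine h.norm_sub_le_of_near hGX (hmem m hm.le) (hmem (m + 1) hm) ?_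
      rw [hstep, div_le_iff₀ hN0]
      linarith
  rw [dist_comm, dist_eq_norm, h0, hNx] at hdist
  refine hdist.trans (le_of_eq ?_)
  simp
  field_simp

/-- In `norm_sub_mul_le` with `η = s * ε`, the right side is of order `s ^ 2` and the left factor of
order `s`. This gives continuity of `g` when a boundary point is approached along the segment from
`c`. -/
theorem exists_norm_sub_le (h : IsTangentGradient X GX f g) (hGX : 0 ≤ GX) {c : E} {ε : ℝ}
    (hX : Convex ℝ X) (hε : 0 < ε) (hc : c ∈ relativeCore X ε) {z : E} (hz : z ∈ X) :
    ∃ C, ∀ s ∈ Set.Ioc (0 : ℝ) 1, ‖g (z + s • (c - z)) - g z‖ ≤ C * s := by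
  refine ⟨GX / 2 * (‖c - z‖ + ε) ^ 2 / ε, fun s hs => ?_⟩
  have h1 := h.norm_sub_mul_le hGX (mul_nonneg hs.1.le hε.le) hz
    (homothety_mem_relativeCore hX hc hz hs)
  rw [add_sub_cancel_left, norm_smul, Real.norm_of_nonneg hs.1.le, ← mul_add, mul_pow, mul_assoc]
    at h1
  rw [div_mul_eq_mul_div, le_div_iff₀ hε]
  nlinarith [hs.1]

/-- A convex function which is smooth on `X` has a Lipschitz tangential gradient on `X`. -/
theorem norm_sub_le [FiniteDimensional ℝ E] (h : IsTangentGradient X GX f g) (hGX : 0 ≤ GX)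
    (hX : Convex ℝ X) {x z : E} (hx : x ∈ X) (hz : z ∈ X) : ‖g x - g z‖ ≤ GX * ‖x - z‖ := by
  obtain ⟨c, -, ε, hε, hc⟩ := exists_relative_ball hX ⟨x, hx⟩
  obtain ⟨C₁, h₁⟩ := h.exists_norm_sub_le hGX hX hε hc hx
  obtain ⟨C₂, h₂⟩ := h.exists_norm_sub_le hGX hX hε hc hz
  -- Both points are pulled towards `c` into a core, which does not increase their distance; then `s
  -- → 0`.
  refine le_of_forall_le_add_mul (C := C₁ + C₂) fun s hs => ?_
  have h3 := h.norm_sub_le_of_relativeCore hGX hX (mul_pos hs.1 hε)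
    (homothety_mem_relativeCore hX hc hx hs) (homothety_mem_relativeCore hX hc hz hs)
  have h4 : ‖x + s • (c - x) - (z + s • (c - z))‖ ≤ ‖x - z‖ := by
    have : x + s • (c - x) - (z + s • (c - z)) = (1 - s) • (x - z) := by
      simp only [smul_sub, sub_smul, one_smul]; abel
    rw [this, norm_smul, Real.norm_of_nonneg (sub_nonneg.2 hs.2)]
    exact mul_le_of_le_one_left (norm_nonneg _) (by linarith [hs.1])
  have h5 := norm_sub_le_norm_sub_add_norm_sub (g x) (g (x + s • (c - x))) (g z)
  have h6 := norm_sub_le_norm_sub_add_norm_sub (g (x + s • (c - x))) (g (z + s • (c - z))) (g z)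
  rw [norm_sub_rev (g x) (g (x + _))] at h5
  nlinarith [h₁ s hs, h₂ s hs, mul_le_mul_of_nonneg_left h4 hGX]

/-- At a core point one can move along `g` itself inside `X`: the tangent rises by `η * ‖g‖`, and
`f` by at most `L * η`. Other points follow in the limit. -/
theorem norm_le [FiniteDimensional ℝ E] (h : IsTangentGradient X GX f g) (hGX : 0 ≤ GX)
    (hX : Convex ℝ X) {L : ℝ} (hL : ∀ x ∈ X, ∀ z ∈ X, |f x - f z| ≤ L * ‖x - z‖) (hL0 : 0 ≤ L) {z : E} (hz : z ∈ X) :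
    ‖g z‖ ≤ L := by
  obtain ⟨c, -, ε, hε, hc⟩ := exists_relative_ball hX ⟨z, hz⟩
  obtain ⟨C, hC⟩ := h.exists_norm_sub_le hGX hX hε hc hz
  refine le_of_forall_le_add_mul (C := C) fun s hs => ?_
  have hη : 0 < s * ε := mul_pos hs.1 hε
  have hb := homothety_mem_relativeCore hX hc hz hs
  set b := z + s • (c - z)
  have hbX := mem_of_mem_relativeCore hη.le hb
  obtain ⟨u, hu, hun, hui⟩ := exists_norm_le_inner_eq (h.mem b hbX) hη.le
  have h1 := h.support _ (hb u hu hun) b hbX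
  have h2 := (le_abs_self _).trans (hL _ (hb u hu hun) b hbX)
  rw [add_sub_cancel_left] at h1 h2
  have h3 : s * ε * ‖g b‖ ≤ s * ε * L := by
    nlinarith [mul_le_mul_of_nonneg_left hun hL0]
  have h4 := le_of_mul_le_mul_left h3 hη
  have h5 := norm_sub_norm_le (g z) (g b)
  rw [norm_sub_rev] at h5
  linarith [hC s hs]

end IsTangentGradient

/-- First-order condition for a convex function differentiable at a point. -/
theorem _root_.ConvexOn.add_inner_gradient_le [CompleteSpace E] {X : Set E} {f : E → ℝ}
    (hf : ConvexOn ℝ X f) {x z : E} (hx : x ∈ X) (hz : z ∈ X) (hd : DifferentiableAt ℝ f z) :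
    f z + inner ℝ (gradient f z) (x - z) ≤ f x := by
  have hline : HasDerivAt (fun s : ℝ => f (AffineMap.lineMap z x s))
      (inner ℝ (gradient f z) (x - z)) 0 := by
    have h1 : HasFDerivAt f (InnerProductSpace.toDual ℝ E (gradient f z))
        (AffineMap.lineMap z x (0 : ℝ)) := by
      rw [AffineMap.lineMap_apply_zero]
      exact hd.hasGradientAt.hasFDerivAt
    exact h1.comp_hasDerivAt (0 : ℝ) AffineMap.hasDerivAt_lineMap
  have hconv := hf.comp_affineMap (AffineMap.lineMap z x : ℝ →ᵃ[ℝ] E)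
  have := hconv.le_slope_of_hasDerivAt (x := 0) (y := 1) (by simpa) (by simpa) one_pos hline
  simp only [slope_def_field, Function.comp_apply, AffineMap.lineMap_apply_zero,
    AffineMap.lineMap_apply_one, sub_zero, div_one] at this
  linarith

end

/-- Differences of points of `X` lie in `vectorSpan ℝ X`, so the projection changes none of the
inner products involved. -/
theorem IsLoss.isTangentGradient {X : Set (EuclideanSpace ℝ (Fin d))} {L GX : ℝ}
    {f : EuclideanSpace ℝ (Fin d) → ℝ} (h : IsLoss X L GX f) :
    IsTangentGradient X GX f fun z => (vectorSpan ℝ X).starProjection (gradient f z) := by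
  have key : ∀ x ∈ X, ∀ z ∈ X, inner ℝ ((vectorSpan ℝ X).starProjection (gradient f z)) (x - z)
      = inner ℝ (gradient f z) (x - z) := fun x hx z hz => by
    have := Submodule.starProjection_inner_eq_zero (K := vectorSpan ℝ X) (gradient f z) (x - z)
      (sub_mem_vectorSpan hx hz)
    rw [inner_sub_left] at this
    linarith
  refine ⟨fun z _ => Submodule.starProjection_apply_mem _ _, fun x hx z hz => ?_,
    fun x hx z hz => ?_⟩
  · rw [key x hx z hz]
    exact h.convex.add_inner_gradient_le hx hz (h.diff z hz)
  · rw [key x hx z hz]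
    linarith [h.smooth x hx z hz]

/-! ### Scalar recursions. -/

section recursions

variable {a b : ℕ → ℝ} {q : ℝ} {N : ℕ}

theorem sum_le_of_succ_le (hN : 1 ≤ N) (hq : 0 ≤ q) (ha : 0 ≤ a N)
    (h : ∀ k ∈ Set.Ico 1 N, a (k + 1) ≤ q * a k + b k) :
    (1 - q) * ∑ k ∈ Finset.Icc 1 N, a k ≤ a 1 + ∑ k ∈ Finset.Ico 1 N, b k := by
  -- Keeping the term `q * a N` makes the induction close; the sign of `a` matters only at the end.
  suffices (1 - q) * ∑ k ∈ Finset.Icc 1 N, a k + q * a N ≤ a 1 + ∑ k ∈ Finset.Ico 1 N, b k by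
    nlinarith
  clear ha
  induction N, hN using Nat.le_induction with
  | base => simp; linarith
  | succ N hN ih =>
    rw [Finset.sum_Icc_succ_top (by omega), Finset.sum_Ico_succ_top hN]
    have h1 := ih fun k hk => h k ⟨hk.1, hk.2.trans (Nat.lt_succ_self N)⟩
    have h2 := h N ⟨hN, Nat.lt_succ_self N⟩
    nlinarith

/-- Only the initial value needs its damping; the powers of `q` on the sources are bounded by one.
-/
theorem le_pow_mul_add_sum_of_succ_le (hq0 : 0 ≤ q) (hq1 : q ≤ 1)
    (hb : ∀ k ∈ Set.Icc 1 N, 0 ≤ b k) (h : ∀ k ∈ Set.Icc 1 N, a (k + 1) ≤ q * a k + b k) :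
    a (N + 1) ≤ q ^ N * a 1 + ∑ k ∈ Finset.Icc 1 N, b k := by
  induction N with
  | zero => simp
  | succ N ih =>
    have h1 := ih (fun k hk => hb k ⟨hk.1, hk.2.trans N.le_succ⟩)
      (fun k hk => h k ⟨hk.1, hk.2.trans N.le_succ⟩)
    have h2 := h (N + 1) ⟨by omega, le_rfl⟩
    have h3 : 0 ≤ ∑ k ∈ Finset.Icc 1 N, b k := Finset.sum_nonneg fun k hk =>
      hb k ⟨(Finset.mem_Icc.1 hk).1, (Finset.mem_Icc.1 hk).2.trans N.le_succ⟩
    rw [Finset.sum_Icc_succ_top (by omega), pow_succ]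
    nlinarith [mul_le_mul_of_nonneg_left h1 hq0, mul_le_mul_of_nonneg_right hq1 h3]

theorem le_pow_mul_add_div_of_succ_le {c : ℝ} (hq0 : 0 ≤ q) (hq1 : q < 1) (hc : 0 ≤ c)
    (h : ∀ k ∈ Set.Icc 1 N, a (k + 1) ≤ q * a k + c) :
    a (N + 1) ≤ q ^ N * a 1 + c / (1 - q) := by
  have hfix : q * (c / (1 - q)) + c = c / (1 - q) := by
    have : 1 - q ≠ 0 := by linarith
    field_simp
    ring
  induction N with
  | zero => simpa using div_nonneg hc (by linarith)
  | succ N ih =>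
    have h1 := ih (fun k hk => h k ⟨hk.1, hk.2.trans N.le_succ⟩)
    have h2 := h (N + 1) ⟨by omega, le_rfl⟩
    rw [pow_succ]
    nlinarith [mul_le_mul_of_nonneg_left h1 hq0]

end recursions

/-! ### Single inner iterations of a round. -/

/-- One round of Frank--Wolfe steps with gradient tracking, for gradient maps `g i`. -/
structure IsRound (X : Set (EuclideanSpace ℝ (Fin d))) (A : Matrix (Fin n) (Fin n) ℝ)
    (g : Fin n → EuclideanSpace ℝ (Fin d) → EuclideanSpace ℝ (Fin d)) (K : ℕ) (α : ℝ)
    (st mx gb gh v : ℕ → Fin n → EuclideanSpace ℝ (Fin d)) : Prop where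
  start_mem : ∀ i, st 1 i ∈ X
  mx_eq : ∀ k ∈ Set.Icc 1 K, mx k = mix A (st k)
  gb_one : gb 1 = fun i => g i (mx 1 i)
  gb_succ : ∀ k ∈ Set.Ico 1 K,
    gb (k + 1) = gh k + ((fun i => g i (mx (k + 1) i)) - fun i => g i (mx k i))
  gh_eq : ∀ k ∈ Set.Icc 1 K, gh k = mix A (gb k)
  v_mem : ∀ k ∈ Set.Icc 1 K, ∀ i, v k i ∈ X
  v_min : ∀ k ∈ Set.Icc 1 K, ∀ i, ∀ y ∈ X, inner ℝ (gh k i) (v k i - y) ≤ 0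
  st_succ : ∀ k ∈ Set.Icc 1 K, st (k + 1) = mx k + α • (v k - mx k)

namespace IsRound

variable {X : Set (EuclideanSpace ℝ (Fin d))} {M ζ L GX α : ℝ} {G : Digraph (Fin n)}
  {A : Matrix (Fin n) (Fin n) ℝ} {f : Fin n → EuclideanSpace ℝ (Fin d) → ℝ}
  {g : Fin n → EuclideanSpace ℝ (Fin d) → EuclideanSpace ℝ (Fin d)} {K : ℕ}
  {st mx gb gh v : ℕ → Fin n → EuclideanSpace ℝ (Fin d)}

section

variable (h : IsRound X A g K α st mx gb gh v) (hX : Convex ℝ X) (hA : IsNetwork ζ G A)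
  (hα : α ∈ Set.Icc (0 : ℝ) 1)

include h hX hA hα

theorem st_mem {k : ℕ} (hk : k ∈ Set.Icc 1 (K + 1)) (i : Fin n) : st k i ∈ X := by
  obtain ⟨hk1, hk2⟩ := hk
  induction k, hk1 using Nat.le_induction generalizing i with
  | base => exact h.start_mem i
  | succ k hk1 ih =>
    have hk : k ∈ Set.Icc 1 K := ⟨hk1, by omega⟩
    rw [h.st_succ k hk, h.mx_eq k hk]
    exact hX.add_smul_sub_mem (mix_mem (st k) hX hA.doubly (ih · (by omega)) i)
      (h.v_mem k hk i) hα

theorem mx_mem {k : ℕ} (hk : k ∈ Set.Icc 1 K) (i : Fin n) : mx k i ∈ X := by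
  rw [h.mx_eq k hk]
  exact mix_mem _ hX hA.doubly (h.st_mem hX hA hα ⟨hk.1, hk.2.trans K.le_succ⟩) i

theorem l2_v_sub_mx_le (hM : ∀ x ∈ X, ∀ z ∈ X, ‖x - z‖ ≤ M) {k : ℕ} (hk : k ∈ Set.Icc 1 K) :
    l2 (v k - mx k) ≤ n * M :=
  l2_le_of_forall_le fun i => hM _ (h.v_mem k hk i) _ (h.mx_mem hX hA hα hk i)

theorem spread_st_succ_le (hn : 0 < n) (hζ : 0 < ζ) (hM : ∀ x ∈ X, ∀ z ∈ X, ‖x - z‖ ≤ M)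
    {k : ℕ} (hk : k ∈ Set.Icc 1 K) :
    spread (st (k + 1)) ≤ sigma n ζ * spread (st k) + α * (n * M) := by
  rw [h.st_succ k hk]
  have h1 := (spread_le_l2 (v k - mx k) hn).trans (h.l2_v_sub_mx_le hX hA hα hM hk)
  have h2 := IsNetwork.spread_mix_le (st k) hζ hA
  rw [← h.mx_eq k hk] at h2
  have h3 := spread_add_le (mx k) (α • (v k - mx k))
  rw [spread_smul, abs_of_nonneg hα.1] at h3
  nlinarith [mul_le_mul_of_nonneg_left h1 hα.1]

theorem l2_mx_succ_sub_le (hM : ∀ x ∈ X, ∀ z ∈ X, ‖x - z‖ ≤ M) {k : ℕ}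
    (hk : k ∈ Set.Ico 1 K) :
    l2 (mx (k + 1) - mx k) ≤ 2 * spread (st k) + α * (n * M) := by
  have hk' : k ∈ Set.Icc 1 K := ⟨hk.1, hk.2.le⟩
  have e : mx (k + 1) - mx k = (mix A (mx k) - mx k) + α • mix A (v k - mx k) := by
    rw [h.mx_eq (k + 1) ⟨by omega, hk.2⟩, h.st_succ k hk', mix_add, mix_smul]
    abel
  have h1 := (l2_mix_le _ hA.doubly).trans (h.l2_v_sub_mx_le hX hA hα hM hk')
  have h2 := l2_mix_sub_le (mx k) hA.doubly
  have h3 : spread (mx k) ≤ spread (st k) := by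
    rw [h.mx_eq k hk', spread, center_mix _ hA.doubly]
    exact l2_mix_le _ hA.doubly
  have h4 := l2_add_le (mix A (mx k) - mx k) (α • mix A (v k - mx k))
  rw [l2_smul, abs_of_nonneg hα.1] at h4
  rw [e]
  nlinarith [mul_le_mul_of_nonneg_left h1 hα.1]

/-- The new estimate mixes the old one plus the gradient increments, and these are Lipschitz in the
movement of the mixed states. -/
theorem spread_gh_succ_le (hn : 0 < n) (hζ : 0 < ζ) (hM : ∀ x ∈ X, ∀ z ∈ X, ‖x - z‖ ≤ M)
    (hGX : 0 ≤ GX) (hlip : ∀ i, ∀ x ∈ X, ∀ z ∈ X, ‖g i x - g i z‖ ≤ GX * ‖x - z‖)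
    {k : ℕ} (hk : k ∈ Set.Ico 1 K) :
    spread (gh (k + 1)) ≤
      sigma n ζ * spread (gh k) + GX * (2 * spread (st k) + α * (n * M)) := by
  have hk' : k ∈ Set.Icc 1 K := ⟨hk.1, hk.2.le⟩
  have hk1 : k + 1 ∈ Set.Icc 1 K := ⟨by omega, hk.2⟩
  set D := (fun i => g i (mx (k + 1) i)) - fun i => g i (mx k i) with hD
  have h1 : l2 D ≤ GX * l2 (mx (k + 1) - mx k) := by
    have := l2_mono (x := D) (y := GX • (mx (k + 1) - mx k)) fun i => by
      rw [Pi.smul_apply, norm_smul, Real.norm_of_nonneg hGX]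
      exact hlip i _ (h.mx_mem hX hA hα hk1 i) _ (h.mx_mem hX hA hα hk' i)
    rwa [l2_smul, abs_of_nonneg hGX] at this
  have h2 := h.l2_mx_succ_sub_le hX hA hα hM hk
  have h3 : spread (mix A D) ≤ l2 D := (spread_le_l2 _ hn).trans (l2_mix_le D hA.doubly)
  rw [h.gh_eq _ hk1, h.gb_succ k hk, mix_add]
  have h4 := spread_add_le (mix A (gh k)) (mix A D)
  have h5 := IsNetwork.spread_mix_le (gh k) hζ hA
  nlinarith [mul_le_mul_of_nonneg_left h2 hGX]

end

theorem spread_gh_one_le (h : IsRound X A g K α st mx gb gh v) (hX : Convex ℝ X)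
    (hA : IsNetwork ζ G A) (hα : α ∈ Set.Icc (0 : ℝ) 1) (hn : 0 < n) (hK : 1 ≤ K)
    (hL : ∀ i, ∀ z ∈ X, ‖g i z‖ ≤ L) : spread (gh 1) ≤ n * L := by
  have h1 : (1 : ℕ) ∈ Set.Icc 1 K := ⟨le_rfl, hK⟩
  rw [h.gh_eq 1 h1, h.gb_one]
  exact (spread_le_l2 _ hn).trans ((l2_mix_le _ hA.doubly).trans
    (l2_le_of_forall_le fun i => hL i _ (h.mx_mem hX hA hα h1 i)))

/-- Gradient tracking preserves the average of the local gradients. -/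
theorem average_gh (h : IsRound X A g K α st mx gb gh v) (hA : IsNetwork ζ G A) {k : ℕ}
    (hk : k ∈ Set.Icc 1 K) : average (gh k) = average fun i => g i (mx k i) := by
  obtain ⟨hk1, hk2⟩ := hk
  induction k, hk1 using Nat.le_induction with
  | base => rw [h.gh_eq 1 ⟨le_rfl, hk2⟩, average_mix _ hA.doubly, h.gb_one]
  | succ k hk1 ih =>
    rw [h.gh_eq _ ⟨by omega, hk2⟩, average_mix _ hA.doubly, h.gb_succ k ⟨hk1, hk2⟩, average_add,
      average_sub, ih (by omega), add_sub_cancel]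

/-- The sum of the gradients at the mixed states is `n` times the average estimate. What remains is
the deviation of agent `i`'s estimate from that average and the move of the gradients from the mixed
states to their average. -/
theorem norm_sum_sub_gh_le (h : IsRound X A g K α st mx gb gh v) (hX : Convex ℝ X)
    (hA : IsNetwork ζ G A) (hα : α ∈ Set.Icc (0 : ℝ) 1) (hn : 0 < n)
    (hGX : 0 ≤ GX) (hlip : ∀ i, ∀ x ∈ X, ∀ z ∈ X, ‖g i x - g i z‖ ≤ GX * ‖x - z‖)
    {k : ℕ} (hk : k ∈ Set.Icc 1 K) (i : Fin n) :
    ‖∑ j, g j (average (st k)) - (n : ℝ) • gh k i‖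
      ≤ n * (spread (gh k) + GX * spread (st k)) := by
  have hmem := average_mem (st k) hX hn (h.st_mem hX hA hα ⟨hk.1, hk.2.trans K.le_succ⟩)
  have hmx : spread (mx k) ≤ spread (st k) := by
    rw [h.mx_eq k hk, spread, center_mix _ hA.doubly]
    exact l2_mix_le _ hA.doubly
  have hav : average (mx k) = average (st k) := by rw [h.mx_eq k hk, average_mix _ hA.doubly]
  have e : ∑ j, g j (average (st k)) - (n : ℝ) • gh k i
      = ∑ j, (g j (average (st k)) - g j (mx k j)) - (n : ℝ) • center (gh k) i := by
    rw [Finset.sum_sub_distrib, sum_eq_smul_average (fun j => g j (mx k j)) hn,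
      ← h.average_gh hA hk, center, smul_sub]
    abel
  rw [e]
  have h1 : ‖∑ j, (g j (average (st k)) - g j (mx k j))‖ ≤ GX * (n * spread (st k)) := by
    calc _ ≤ ∑ j, ‖g j (average (st k)) - g j (mx k j)‖ := norm_sum_le _ _
      _ ≤ ∑ j, GX * ‖center (mx k) j‖ := Finset.sum_le_sum fun j _ => by
          rw [center, hav, norm_sub_rev (mx k j)]
          exact hlip j _ hmem _ (h.mx_mem hX hA hα hk j)
      _ ≤ GX * (n * spread (mx k)) := by
          rw [← Finset.mul_sum]
          exact mul_le_mul_of_nonneg_left (sum_le_l2 _) hGX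
      _ ≤ _ := by gcongr
  have h2 : ‖(n : ℝ) • center (gh k) i‖ ≤ n * spread (gh k) := by
    rw [norm_smul, Real.norm_natCast]
    exact mul_le_mul_of_nonneg_left (norm_le_l2 _ i) (by positivity)
  refine (_root_.norm_sub_le _ _).trans ?_
  linarith

/-- One Frank--Wolfe step on the average contracts the suboptimality up to the tracking error. -/
theorem suboptimality_succ_le (h : IsRound X A g K α st mx gb gh v) (hX : Convex ℝ X)
    (hA : IsNetwork ζ G A) (hα : α ∈ Set.Icc (0 : ℝ) 1) (hn : 0 < n)
    (hM : ∀ x ∈ X, ∀ z ∈ X, ‖x - z‖ ≤ M)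
    (hGX : 0 ≤ GX) (hlip : ∀ i, ∀ x ∈ X, ∀ z ∈ X, ‖g i x - g i z‖ ≤ GX * ‖x - z‖)
    (hg : ∀ i, IsTangentGradient X GX (f i) (g i)) {y : EuclideanSpace ℝ (Fin d)} (hy : y ∈ X)
    {k : ℕ} (hk : k ∈ Set.Icc 1 K) :
    ∑ i, f i (average (st (k + 1))) - ∑ i, f i y ≤
      (1 - α) * (∑ i, f i (average (st k)) - ∑ i, f i y)
        + α * (M * (n * (spread (gh k) + GX * spread (st k))) + α * (n * GX * M ^ 2 / 2)) := by
  have hst := h.st_mem hX hA hα ⟨hk.1, hk.2.trans K.le_succ⟩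
  have hst' := h.st_mem hX hA hα (k := k + 1) ⟨by omega, Nat.succ_le_succ hk.2⟩
  have hmem := average_mem (st k) hX hn hst
  have hmem' := average_mem (st (k + 1)) hX hn hst'
  have hvmem := average_mem (v k) hX hn (h.v_mem k hk)
  have hav : average (st (k + 1)) - average (st k) = α • (average (v k) - average (st k)) := by
    rw [h.st_succ k hk, average_add, average_smul, average_sub, h.mx_eq k hk,
      average_mix _ hA.doubly, add_sub_cancel_left]
  set x := average (st k)
  set γ := ∑ i, g i x with hγ
  set R := n * (spread (gh k) + GX * spread (st k)) with hR
  have hn' : (0 : ℝ) < n := by positivity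
  have hsmooth : ∑ i, f i (average (st (k + 1))) ≤ ∑ i, f i x
      + α * inner ℝ γ (average (v k) - x) + n * (GX / 2 * (α * M) ^ 2) := by
    calc _ ≤ ∑ i, (f i x + α * inner ℝ (g i x) (average (v k) - x) + GX / 2 * (α * M) ^ 2) :=
          Finset.sum_le_sum fun i _ => by
            refine ((hg i).smooth _ hmem' x hmem).trans ?_
            rw [hav, inner_smul_right, norm_smul, Real.norm_of_nonneg hα.1]
            have := hα.1
            gcongr
            exact hM _ hvmem _ hmem
      _ = _ := by
          simp [Finset.sum_add_distrib, hγ, sum_inner, ← Finset.mul_sum]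
  have hfirst : inner ℝ γ (y - x) ≤ ∑ i, f i y - ∑ i, f i x := by
    rw [hγ, sum_inner, ← Finset.sum_sub_distrib]
    exact Finset.sum_le_sum fun i _ => by linarith [(hg i).support y hy x hmem]
  -- The oracle is optimal for `gh k i`, not for `γ`; replacing one by the other costs `R` times the
  -- diameter.
  have hv : ∀ i, inner ℝ γ (v k i - x) ≤ ∑ i, f i y - ∑ i, f i x + M * R := fun i => by
    have e : inner ℝ γ (v k i - x) = inner ℝ γ (y - x) + n * inner ℝ (gh k i) (v k i - y)
        + inner ℝ (γ - (n : ℝ) • gh k i) (v k i - y) := by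
      rw [inner_sub_left, inner_smul_left, ← sub_add_sub_cancel (v k i) y x, inner_add_right]
      simp only [conj_trivial]
      ring
    have h1 : inner ℝ (γ - (n : ℝ) • gh k i) (v k i - y) ≤ R * M :=
      (real_inner_le_norm _ _).trans (mul_le_mul
        (h.norm_sum_sub_gh_le hX hA hα hn hGX hlip hk i) (hM _ (h.v_mem k hk i) y hy)
        (norm_nonneg _) (by
          have := spread_nonneg (gh k)
          have := spread_nonneg (st k)
          positivity))
    have h2 := mul_nonpos_of_nonneg_of_nonpos hn'.le (h.v_min k hk i y hy)
    linarith
  have hvbar : inner ℝ γ (average (v k) - x) ≤ ∑ i, f i y - ∑ i, f i x + M * R := by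
    have e : (n : ℝ) * inner ℝ γ (average (v k) - x) = ∑ i, inner ℝ γ (v k i - x) := by
      rw [← inner_sum, Finset.sum_sub_distrib, sum_eq_smul_average (v k) hn, ← inner_smul_right,
        smul_sub]
      simp [Nat.cast_smul_eq_nsmul]
    have h1 := Finset.sum_le_sum fun i (_ : i ∈ Finset.univ) => hv i
    rw [← e, Finset.sum_const, Finset.card_univ, Fintype.card_fin, nsmul_eq_mul] at h1
    exact le_of_mul_le_mul_left h1 hn'
  nlinarith [mul_le_mul_of_nonneg_left hvbar hα.1]

end IsRound

/-! ### Sign and size of the constants. -/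

section constants

variable {ζ M L GX : ℝ}

theorem Gam_eq_inv_sigma : Gam n ζ = (sigma n ζ)⁻¹ := rfl

theorem sigma_lt_one (hn : 0 < n) (hζ : 0 < ζ) : sigma n ζ < 1 := by
  have : 0 < ζ / (4 * (n : ℝ) ^ 2) := by positivity
  rw [sigma]
  linarith

theorem one_le_Gam (hn : 0 < n) (hζ : 0 < ζ) (hσ : 0 < sigma n ζ) : 1 ≤ Gam n ζ := by
  rw [Gam_eq_inv_sigma]
  exact (one_le_inv₀ hσ).2 (sigma_lt_one hn hζ).le

theorem D₁_nonneg (x₁ : Fin n → EuclideanSpace ℝ (Fin d)) (hn : 0 < n) (hζ : 0 < ζ)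
    (hσ : 0 < sigma n ζ) (hM : 0 ≤ M) (hL : 0 ≤ L) (hGX : 0 ≤ GX) : 0 ≤ D₁ ζ M L GX x₁ := by
  have hΓ := one_le_Gam hn hζ hσ
  have hp : 0 < 1 - sigma n ζ := sub_pos.2 (sigma_lt_one hn hζ)
  have : 0 ≤ ∑ j, (‖x₁ j‖ + M) := Finset.sum_nonneg fun j _ => by positivity
  rw [D₁]
  positivity

theorem D₂_nonneg (hn : 0 < n) (hζ : 0 < ζ) (hσ : 0 < sigma n ζ) (hM : 0 ≤ M) (hGX : 0 ≤ GX) :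
    0 ≤ D₂ n ζ M GX := by
  have hΓ := one_le_Gam hn hζ hσ
  have hp : 0 < 1 - sigma n ζ := sub_pos.2 (sigma_lt_one hn hζ)
  rw [D₂]
  positivity

/-- Here `Ss` and `Sg` stand for the sums over a round of the spreads of states and estimates, and
`κ` for `K * α`. After elimination of both, `D₁` absorbs the terms free of `κ` and `D₂` those with
it, using only `1 ≤ n`, `1 ≤ Γ` and `n * M ≤ ∑ j, (‖x₁ j‖ + M)`; so `x₁` may be any family. -/
theorem tracking_bound_le_D {κ Ss Sg : ℝ} (x₁ : Fin n → EuclideanSpace ℝ (Fin d)) (hn : 0 < n)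
    (hζ : 0 < ζ) (hσ : 0 < sigma n ζ) (hM : 0 ≤ M) (hL : 0 ≤ L) (hGX : 0 ≤ GX) (hκ : 0 ≤ κ)
    (hSs : (1 - sigma n ζ) * Ss ≤ n * M + κ * (n * M))
    (hSg : (1 - sigma n ζ) * Sg ≤ n * L + GX * (2 * Ss + κ * (n * M))) :
    n * (Sg + GX * Ss) ≤ D₁ ζ M L GX x₁ + κ * D₂ n ζ M GX := by
  have hΓ := one_le_Gam hn hζ hσ
  have hp : 0 < 1 - sigma n ζ := sub_pos.2 (sigma_lt_one hn hζ)
  have hn1 : (1 : ℝ) ≤ n := by exact_mod_cast hn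
  have hsum : n * M ≤ ∑ j, (‖x₁ j‖ + M) := by
    simpa using Finset.sum_le_sum fun j (_ : j ∈ Finset.univ) =>
      le_add_of_nonneg_left (a := M) (norm_nonneg (x₁ j))
  rw [D₁, D₂]
  generalize Gam n ζ = Γ at *
  generalize 1 - sigma n ζ = p at *
  set N : ℝ := (n : ℝ)
  have hΓn : 1 ≤ N * Γ := by nlinarith
  rw [mul_comm, ← le_div_iff₀ hp] at hSs hSg
  set u : ℝ := 1 / p with hu
  have hu0 : 0 < u := by positivity
  rw [div_eq_mul_one_div, ← hu] at hSs hSg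
  have hD1 : (2 * N * u * GX + GX) * (N * u * (N * M)) + N ^ 2 * u * L
      ≤ (2 * N * Γ * GX / p + GX) * (N * M + N * Γ / p * ∑ j, (‖x₁ j‖ + M))
        + N ^ 2 * Γ * L / p := by
    have e1 : 2 * N * Γ * GX / p = 2 * N * Γ * GX * u := by rw [hu]; ring
    have e2 : N * Γ / p = N * Γ * u := by rw [hu]; ring
    have e3 : N ^ 2 * Γ * L / p = N ^ 2 * Γ * L * u := by rw [hu]; ring
    rw [e1, e2, e3]
    have h1 : 2 * N * u * GX ≤ 2 * N * Γ * GX * u := by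
      have : 0 ≤ 2 * N * GX * u := by positivity
      nlinarith
    have h2 : N * u * (N * M) ≤ N * M + N * Γ * u * ∑ j, (‖x₁ j‖ + M) := by
      have h3 : N * u * (N * M) ≤ N * Γ * u * (N * M) := by
        have : 0 ≤ N * u * (N * M) := by positivity
        nlinarith
      have h4 : N * Γ * u * (N * M) ≤ N * Γ * u * ∑ j, (‖x₁ j‖ + M) := by gcongr
      have : 0 ≤ N * M := by positivity
      linarith
    have h5 : N ^ 2 * u * L ≤ N ^ 2 * Γ * L * u := by
      have : 0 ≤ N ^ 2 * u * L := by positivity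
      nlinarith
    gcongr
  have hD2 : 2 * N ^ 2 * GX * M * u * (u + 1) ≤
      2 * N ^ 2 * Γ * GX * M / p * (N * Γ / p + 3) + 2 * N * M * GX := by
    have e1 : 2 * N ^ 2 * Γ * GX * M / p = 2 * N ^ 2 * Γ * GX * M * u := by rw [hu]; ring
    have e2 : N * Γ / p = N * Γ * u := by rw [hu]; ring
    rw [e1, e2]
    have h1 : 2 * N ^ 2 * GX * M * u ≤ 2 * N ^ 2 * Γ * GX * M * u := by
      have : 0 ≤ 2 * N ^ 2 * GX * M * u := by positivity
      nlinarith
    have h2 : u + 1 ≤ N * Γ * u + 3 := by nlinarith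
    have h3 : 0 ≤ 2 * N * M * GX := by positivity
    have h4 := mul_le_mul h1 h2 (by positivity) (by positivity)
    linarith
  have hW : N * (Sg + GX * Ss) ≤ (2 * u * GX + GX) * (N * (N * M) * u) + N ^ 2 * u * L
      + κ * (2 * N ^ 2 * GX * M * u * (u + 1)) := by
    have h1 : N * Sg ≤ N * ((N * L + GX * (2 * Ss + κ * (N * M))) * u) := by gcongr
    have h2 : N * (2 * GX * u + GX) * Ss
        ≤ N * (2 * GX * u + GX) * ((N * M + κ * (N * M)) * u) := by gcongr
    nlinarith
  have hlast : (2 * u * GX + GX) * (N * (N * M) * u)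
      ≤ (2 * N * u * GX + GX) * (N * u * (N * M)) := by
    have h1 : 2 * u * GX ≤ 2 * N * u * GX := by
      have : 0 ≤ u * GX := by positivity
      nlinarith
    have h2 : N * (N * M) * u = N * u * (N * M) := by ring
    rw [h2]
    gcongr
  have := mul_le_mul_of_nonneg_left hD2 hκ
  linarith

end constants

/-! ### Estimates over a whole round. -/

namespace IsRound

variable {X : Set (EuclideanSpace ℝ (Fin d))} {M ζ L GX α : ℝ} {G : Digraph (Fin n)}
  {A : Matrix (Fin n) (Fin n) ℝ} {f : Fin n → EuclideanSpace ℝ (Fin d) → ℝ}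
  {g : Fin n → EuclideanSpace ℝ (Fin d) → EuclideanSpace ℝ (Fin d)} {K : ℕ}
  {st mx gb gh v : ℕ → Fin n → EuclideanSpace ℝ (Fin d)}

theorem spread_final_le (h : IsRound X A g K α st mx gb gh v) (hX : Convex ℝ X)
    (hA : IsNetwork ζ G A) (hα : α ∈ Set.Icc (0 : ℝ) 1) (hn : 0 < n) (hζ : 0 < ζ)
    (hM0 : 0 ≤ M) (hM : ∀ x ∈ X, ∀ z ∈ X, ‖x - z‖ ≤ M) :
    spread (st (K + 1)) ≤
      sigma n ζ ^ K * spread (st 1) + α * (n * M) / (1 - sigma n ζ) := by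
  refine le_pow_mul_add_div_of_succ_le (a := fun k => spread (st k))
    (hA.sigma_pos ⟨0, hn⟩).le (sigma_lt_one hn hζ) ?_
    fun k hk => h.spread_st_succ_le hX hA hα hn hζ hM hk
  have := hα.1
  positivity

theorem sum_tracking_error_le (h : IsRound X A g K α st mx gb gh v) (hX : Convex ℝ X)
    (hA : IsNetwork ζ G A) (hα : α ∈ Set.Icc (0 : ℝ) 1) (hn : 0 < n) (hK : 1 ≤ K) (hζ : 0 < ζ)
    (hM0 : 0 ≤ M) (hM : ∀ x ∈ X, ∀ z ∈ X, ‖x - z‖ ≤ M) (hGX : 0 ≤ GX) (hL0 : 0 ≤ L)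
    (hlip : ∀ i, ∀ x ∈ X, ∀ z ∈ X, ‖g i x - g i z‖ ≤ GX * ‖x - z‖)
    (hL : ∀ i, ∀ z ∈ X, ‖g i z‖ ≤ L) (x₁ : Fin n → EuclideanSpace ℝ (Fin d)) :
    ∑ k ∈ Finset.Icc 1 K, n * (spread (gh k) + GX * spread (st k))
      ≤ D₁ ζ M L GX x₁ + K * α * D₂ n ζ M GX := by
  have hσ := hA.sigma_pos ⟨0, hn⟩
  have hα0 := hα.1
  have hsub : Finset.Ico 1 K ⊆ Finset.Icc 1 K := Finset.Ico_subset_Icc_self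
  have hconst : ∑ _k ∈ Finset.Ico 1 K, α * (n * M) ≤ K * α * (n * M) := by
    refine (Finset.sum_le_sum_of_subset_of_nonneg hsub fun _ _ _ => by positivity).trans ?_
    simp [mul_assoc]
  rw [← Finset.mul_sum, Finset.sum_add_distrib, ← Finset.mul_sum]
  refine tracking_bound_le_D x₁ hn hζ hσ hM0 hL0 hGX (by positivity) ?_ ?_
  · refine (sum_le_of_succ_le hK hσ.le (spread_nonneg _) fun k hk =>
      h.spread_st_succ_le hX hA hα hn hζ hM ⟨hk.1, hk.2.le⟩).trans (add_le_add ?_ hconst)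
    -- The diameter bounds the initial spread of any round, so the estimate is uniform in the round.
    exact l2_le_of_forall_le fun i => hM _ (h.start_mem i) _ (average_mem _ hX hn h.start_mem)
  · refine (sum_le_of_succ_le hK hσ.le (spread_nonneg _) fun k hk =>
      h.spread_gh_succ_le hX hA hα hn hζ hM hGX hlip hk).trans
        (add_le_add (h.spread_gh_one_le hX hA hα hn hK hL) ?_)
    rw [← Finset.mul_sum, Finset.sum_add_distrib, ← Finset.mul_sum]
    have := Finset.sum_le_sum_of_subset_of_nonneg (f := fun k => spread (st k)) hsub
      fun _ _ _ => spread_nonneg _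
    gcongr

theorem suboptimality_final_le (h : IsRound X A g K α st mx gb gh v) (hX : Convex ℝ X)
    (hA : IsNetwork ζ G A) (hα : α ∈ Set.Icc (0 : ℝ) 1) (hn : 0 < n) (hK : 1 ≤ K) (hζ : 0 < ζ)
    (hM0 : 0 ≤ M) (hM : ∀ x ∈ X, ∀ z ∈ X, ‖x - z‖ ≤ M) (hGX : 0 ≤ GX) (hL0 : 0 ≤ L)
    (hlip : ∀ i, ∀ x ∈ X, ∀ z ∈ X, ‖g i x - g i z‖ ≤ GX * ‖x - z‖)
    (hL : ∀ i, ∀ z ∈ X, ‖g i z‖ ≤ L) (hg : ∀ i, IsTangentGradient X GX (f i) (g i))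
    {y : EuclideanSpace ℝ (Fin d)} (hy : y ∈ X) (x₁ : Fin n → EuclideanSpace ℝ (Fin d)) :
    ∑ i, f i (average (st (K + 1))) - ∑ i, f i y ≤
      (1 - α) ^ K * (∑ i, f i (average (st 1)) - ∑ i, f i y)
        + α * (M * (D₁ ζ M L GX x₁ + K * α * D₂ n ζ M GX) + K * α * (n * GX * M ^ 2 / 2)) := by
  have hα0 := hα.1
  refine (le_pow_mul_add_sum_of_succ_le
    (a := fun k => ∑ i, f i (average (st k)) - ∑ i, f i y)
    (b := fun k => α * (M * (n * (spread (gh k) + GX * spread (st k)))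
      + α * (n * GX * M ^ 2 / 2))) (sub_nonneg.2 hα.2) (by linarith)
    (fun k _ => ?_)
    fun k hk => h.suboptimality_succ_le hX hA hα hn hM hGX hlip hg hy hk).trans ?_
  · have := spread_nonneg (gh k)
    have := spread_nonneg (st k)
    positivity
  · have := h.sum_tracking_error_le hX hA hα hn hK hζ hM0 hM hGX hL0 hlip hL x₁
    rw [← Finset.mul_sum, Finset.sum_add_distrib, ← Finset.mul_sum, Finset.sum_const, Nat.card_Icc,
      nsmul_eq_mul, Nat.add_sub_cancel, ← mul_assoc (K : ℝ)]
    gcongr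

end IsRound

/-! ### Change of the losses between points and between rounds. -/

section

variable {X : Set (EuclideanSpace ℝ (Fin d))} {T : ℕ} {M L GX : ℝ}
  {f : Fin n → ℕ → EuclideanSpace ℝ (Fin d) → ℝ}

/-- One term of the function variation. -/
theorem abs_sub_le_iSup (hM : ∀ x ∈ X, ∀ z ∈ X, ‖x - z‖ ≤ M) (hL : 0 ≤ L)
    (hf : ∀ i, ∀ t ∈ Set.Icc 1 T, IsLoss X L GX (f i t)) {t : ℕ} (ht : t ∈ Set.Ico 1 T)
    (i : Fin n) {x : EuclideanSpace ℝ (Fin d)} (hx : x ∈ X) :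
    |f i (t + 1) x - f i t x| ≤ ⨆ i : Fin n, ⨆ x : X, |f i (t + 1) x - f i t x| := by
  -- An unbounded real supremum would be `0`; the Lipschitz bounds and the finite diameter exclude
  -- this.
  have hbdd : BddAbove (Set.range fun x : X => |f i (t + 1) x - f i t x|) := by
    refine ⟨|f i (t + 1) x - f i t x| + 2 * (L * M), ?_⟩
    rintro _ ⟨z, rfl⟩
    have h1 := abs_le.1 ((hf i t ⟨ht.1, ht.2.le⟩).lipschitz z z.2 x hx)
    have h2 := abs_le.1 ((hf i (t + 1) ⟨by omega, ht.2⟩).lipschitz z z.2 x hx)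
    have h3 := mul_le_mul_of_nonneg_left (hM z z.2 x hx) hL
    have h4 := abs_le.1 (le_refl |f i (t + 1) x - f i t x|)
    exact abs_le.2 ⟨by linarith, by linarith⟩
  exact (le_ciSup hbdd ⟨x, hx⟩).trans
    (le_ciSup (f := fun i => ⨆ x : X, |f i (t + 1) x - f i t x|) (Set.finite_range _).bddAbove i)

theorem abs_globalLoss_sub_le {t : ℕ} (hf : ∀ i, IsLoss X L GX (f i t))
    {x z : EuclideanSpace ℝ (Fin d)} (hx : x ∈ X) (hz : z ∈ X) :
    |globalLoss f t x - globalLoss f t z| ≤ n * (L * ‖x - z‖) := by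
  rw [globalLoss, globalLoss, ← Finset.sum_sub_distrib]
  refine (Finset.abs_sum_le_sum_abs _ _).trans ?_
  simpa using Finset.sum_le_sum fun i (_ : i ∈ Finset.univ) => (hf i).lipschitz x hx z hz

theorem abs_globalLoss_succ_sub_le (hM : ∀ x ∈ X, ∀ z ∈ X, ‖x - z‖ ≤ M) (hL : 0 ≤ L)
    (hf : ∀ i, ∀ t ∈ Set.Icc 1 T, IsLoss X L GX (f i t)) {t : ℕ} (ht : t ∈ Set.Ico 1 T)
    {x : EuclideanSpace ℝ (Fin d)} (hx : x ∈ X) :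
    |globalLoss f (t + 1) x - globalLoss f t x|
      ≤ n * ⨆ i : Fin n, ⨆ x : X, |f i (t + 1) x - f i t x| := by
  rw [globalLoss, globalLoss, ← Finset.sum_sub_distrib]
  refine (Finset.abs_sum_le_sum_abs _ _).trans ?_
  simpa using Finset.sum_le_sum fun i (_ : i ∈ Finset.univ) => abs_sub_le_iSup hM hL hf ht i hx

end

/-! ### Recursions over the rounds. -/

namespace IsRun

variable {X : Set (EuclideanSpace ℝ (Fin d))} {T : ℕ} {M ζ L GX ρ : ℝ}
  {G : ℕ → Digraph (Fin n)} {A : ℕ → Matrix (Fin n) (Fin n) ℝ}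
  {f : Fin n → ℕ → EuclideanSpace ℝ (Fin d) → ℝ} {K : ℕ → ℕ} {α : ℕ → ℝ} {w : Variables n d}

/-- The projection is linear, so it commutes with mixing and tracking. The oracle's optimality tests
the estimates only against differences of points of `X`, so it survives the projection. -/
theorem isRound (hw : IsRun X T G A f K α w) (hnet : ∀ t ∈ Set.Icc 1 T, IsNetwork ζ (G t) (A t))
    {t : ℕ} (ht : t ∈ Set.Icc 1 T) (hx : ∀ i, w.x i t ∈ X) :
    IsRound X (A t) (fun i z => (vectorSpan ℝ X).starProjection (gradient (f i t) z)) (K t) (α t)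
      (fun k i => w.state i t k) (fun k i => w.mixed i t k)
      (fun k i => (vectorSpan ℝ X).starProjection (w.gradBar i t k))
      (fun k i => (vectorSpan ℝ X).starProjection (w.gradHat i t k))
      (fun k i => w.v i t k) where
  start_mem i := by rw [hw.state_one i t ht]; exact hx i
  mx_eq k hk := by
    funext i
    rw [(hnet t ht).mix_eq, hw.mixed_eq i t ht k hk]
  gb_one := by
    funext i
    rw [hw.gradBar_one i t ht]
  gb_succ k hk := by
    funext i
    simp only [hw.gradBar_succ i t ht k hk, map_sub, map_add, Pi.add_apply, Pi.sub_apply]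
    abel
  gh_eq k hk := by
    funext i
    rw [(hnet t ht).mix_eq, hw.gradHat_eq i t ht k hk]
    simp
  v_mem k hk i := hw.v_mem i t ht k hk
  v_min k hk i y hy := by
    have h1 := Submodule.starProjection_inner_eq_zero (K := vectorSpan ℝ X) (w.gradHat i t k)
      (w.v i t k - y) (sub_mem_vectorSpan (hw.v_mem i t ht k hk) hy)
    have h2 := hw.v_min i t ht k hk y hy
    rw [inner_sub_left, sub_eq_zero] at h1
    rw [← h1, real_inner_comm, inner_sub_left]
    linarith
  st_succ k hk := by
    funext i
    simp [hw.state_succ i t ht k hk]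

theorem x_mem (hw : IsRun X T G A f K α w) (hX : Convex ℝ X)
    (hnet : ∀ t ∈ Set.Icc 1 T, IsNetwork ζ (G t) (A t))
    (hα : ∀ t ∈ Set.Icc 1 T, α t ∈ Set.Icc (0 : ℝ) 1) {t : ℕ} (ht : t ∈ Set.Icc 1 (T + 1))
    (i : Fin n) : w.x i t ∈ X := by
  obtain ⟨h1, h2⟩ := ht
  induction t, h1 using Nat.le_induction generalizing i with
  | base => exact hw.init i
  | succ t h1 ih =>
    have ht : t ∈ Set.Icc 1 T := ⟨h1, by omega⟩
    rw [hw.x_succ i t ht]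
    exact (hw.isRound hnet ht (ih · (by omega))).st_mem hX (hnet t ht) (hα t ht)
      ⟨by omega, le_rfl⟩ i

theorem step_mem_Icc {k : ℕ} {a : ℝ} (hρ : 1 ≤ ρ) (hk : 1 ≤ k) (ha : a = 1 / (ρ * (k : ℝ))) :
    a ∈ Set.Icc (0 : ℝ) 1 := by
  have h1 : (1 : ℝ) ≤ k := by exact_mod_cast hk
  rw [ha]
  exact ⟨by positivity, div_le_one_of_le₀ (by nlinarith) (by positivity)⟩

/-- The total distance from consensus over all rounds. -/
theorem sum_spread_le
    (hw : IsRun X T G A f K α w) (hX : Convex ℝ X)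
    (hnet : ∀ t ∈ Set.Icc 1 T, IsNetwork ζ (G t) (A t)) (hζ : 0 < ζ) (hT : 1 ≤ T)
    (hM : ∀ x ∈ X, ∀ z ∈ X, ‖x - z‖ ≤ M) (hK : ∀ t ∈ Set.Icc 1 T, 1 ≤ K t) (hρ : 1 ≤ ρ)
    (hα : ∀ t ∈ Set.Icc 1 T, α t = 1 / (ρ * (K t : ℝ)))
    (hKmono : MonotoneOn K (Set.Icc 1 T)) (j : Fin n) :
    (1 - sigma n ζ ^ K 1) * ∑ t ∈ Finset.Icc 1 T, spread (fun i => w.x i t)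
      ≤ spread (fun i => w.x i 1)
        + n * M / (ρ * (1 - sigma n ζ)) * ∑ t ∈ Finset.Icc 1 T, 1 / (K t : ℝ) := by
  have hn : 0 < n := j.pos
  have hρ0 : 0 < ρ := by linarith
  have hM0 : 0 ≤ M := (norm_nonneg _).trans (hM _ (hw.init j) _ (hw.init j))
  have h1T : (1 : ℕ) ∈ Set.Icc 1 T := ⟨le_rfl, hT⟩
  have hαmem : ∀ t ∈ Set.Icc 1 T, α t ∈ Set.Icc (0 : ℝ) 1 := fun t ht =>
    step_mem_Icc hρ (hK t ht) (hα t ht)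
  have hKpos : ∀ t ∈ Set.Icc 1 T, (0 : ℝ) < K t := fun t ht => by exact_mod_cast hK t ht
  have hσ : 0 < sigma n ζ := (hnet 1 h1T).sigma_pos j
  have hσ1 : sigma n ζ < 1 := sigma_lt_one hn hζ
  have hxmem : ∀ t ∈ Set.Icc 1 T, ∀ i, w.x i t ∈ X := fun t ht =>
    hw.x_mem hX hnet hαmem ⟨ht.1, ht.2.trans T.le_succ⟩
  have hround := fun t ht => hw.isRound hnet (t := t) ht (hxmem t ht)
  set xs : ℕ → Fin n → EuclideanSpace ℝ (Fin d) := fun t i => w.x i t with hxs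
  set x₁ : Fin n → EuclideanSpace ℝ (Fin d) := fun i => w.x i 1 with hx₁
  have hstate_one : ∀ t ∈ Set.Icc 1 T, (fun i => w.state i t 1) = xs t := fun t ht =>
    funext fun i => hw.state_one i t ht
  have hstate_last : ∀ t ∈ Set.Icc 1 T, (fun i => w.state i t (K t + 1)) = xs (t + 1) :=
    fun t ht => funext fun i => (hw.x_succ i t ht).symm
  have hsubR : ∑ t ∈ Finset.Ico 1 T, 1 / (K t : ℝ) ≤ ∑ t ∈ Finset.Icc 1 T, 1 / (K t : ℝ) :=
    Finset.sum_le_sum_of_subset_of_nonneg Finset.Ico_subset_Icc_self fun _ _ _ => by positivity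
  refine (sum_le_of_succ_le (b := fun t => n * M / (ρ * (1 - sigma n ζ)) * (1 / (K t : ℝ)))
    hT (by positivity) (spread_nonneg _) fun t ht => ?_).trans ?_
  · have ht' : t ∈ Set.Icc 1 T := ⟨ht.1, ht.2.le⟩
    have h1 := (hround t ht').spread_final_le hX (hnet t ht') (hαmem t ht') hn hζ hM0 hM
    simp only [hstate_one t ht', hstate_last t ht', hα t ht'] at h1
    -- Monotonicity of `K` gives one contraction factor for all rounds.
    have h2 : sigma n ζ ^ K t ≤ sigma n ζ ^ K 1 :=
      pow_le_pow_of_le_one hσ.le hσ1.le (hKmono h1T ht' ht.1)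
    have h3 := mul_le_mul_of_nonneg_right h2 (spread_nonneg (xs t))
    have h4 : 1 / (ρ * (K t : ℝ)) * (n * M) / (1 - sigma n ζ)
        = n * M / (ρ * (1 - sigma n ζ)) * (1 / (K t : ℝ)) := by
      have := hKpos t ht'
      have : 1 - sigma n ζ ≠ 0 := by linarith
      field_simp
    linarith
  · rw [← Finset.mul_sum]
    have : 0 ≤ n * M / (ρ * (1 - sigma n ζ)) :=
      div_nonneg (by positivity) (mul_nonneg hρ0.le (by linarith))
    gcongr

/-- The total suboptimality of the averages over all rounds. -/
theorem sum_suboptimality_le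
    (hw : IsRun X T G A f K α w) (hX : Convex ℝ X)
    (hnet : ∀ t ∈ Set.Icc 1 T, IsNetwork ζ (G t) (A t)) (hζ : 0 < ζ) (hT : 1 ≤ T)
    (hM : ∀ x ∈ X, ∀ z ∈ X, ‖x - z‖ ≤ M) (hK : ∀ t ∈ Set.Icc 1 T, 1 ≤ K t) (hρ : 1 ≤ ρ)
    (hα : ∀ t ∈ Set.Icc 1 T, α t = 1 / (ρ * (K t : ℝ)))
    (hL : 0 < L) (hGX : 0 < GX) (hf : ∀ i, ∀ t ∈ Set.Icc 1 T, IsLoss X L GX (f i t))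
    {xstar : ℕ → EuclideanSpace ℝ (Fin d)}
    (hstar : ∀ t ∈ Set.Icc 1 T,
      xstar t ∈ X ∧ ∀ y ∈ X, globalLoss f t (xstar t) ≤ globalLoss f t y) (j : Fin n) {B : ℝ}
    (hB : B = M * (1 / ρ * (D₁ ζ M L GX (fun i => w.x i 1) + 1 / ρ * D₂ n ζ M GX))
      + n * GX * M ^ 2 / (2 * ρ)) :
    (1 - Real.exp (-(1 / ρ))) * ∑ t ∈ Finset.Icc 1 T,
        (globalLoss f t (average fun i => w.x i t) - globalLoss f t (xstar t))
      ≤ n * L * M + (2 * n * functionVariation X f T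
        + B * ∑ t ∈ Finset.Icc 1 T, 1 / (K t : ℝ)) := by
  have hn : 0 < n := j.pos
  have hρ0 : 0 < ρ := by linarith
  have hM0 : 0 ≤ M := (norm_nonneg _).trans (hM _ (hw.init j) _ (hw.init j))
  have h1T : (1 : ℕ) ∈ Set.Icc 1 T := ⟨le_rfl, hT⟩
  have hαmem : ∀ t ∈ Set.Icc 1 T, α t ∈ Set.Icc (0 : ℝ) 1 := fun t ht =>
    step_mem_Icc hρ (hK t ht) (hα t ht)
  have hKpos : ∀ t ∈ Set.Icc 1 T, (0 : ℝ) < K t := fun t ht => by exact_mod_cast hK t ht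
  have hσ : 0 < sigma n ζ := (hnet 1 h1T).sigma_pos j
  have hKα : ∀ t ∈ Set.Icc 1 T, K t * α t = 1 / ρ := fun t ht => by
    have := hKpos t ht
    rw [hα t ht]
    field_simp
  have hxmem : ∀ t ∈ Set.Icc 1 T, ∀ i, w.x i t ∈ X := fun t ht =>
    hw.x_mem hX hnet hαmem ⟨ht.1, ht.2.trans T.le_succ⟩
  have hround := fun t ht => hw.isRound hnet (t := t) ht (hxmem t ht)
  set xs : ℕ → Fin n → EuclideanSpace ℝ (Fin d) := fun t i => w.x i t with hxs
  set x₁ : Fin n → EuclideanSpace ℝ (Fin d) := fun i => w.x i 1 with hx₁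
  have hstate_one : ∀ t ∈ Set.Icc 1 T, (fun i => w.state i t 1) = xs t := fun t ht =>
    funext fun i => hw.state_one i t ht
  have hstate_last : ∀ t ∈ Set.Icc 1 T, (fun i => w.state i t (K t + 1)) = xs (t + 1) :=
    fun t ht => funext fun i => (hw.x_succ i t ht).symm
  have hsubR : ∑ t ∈ Finset.Ico 1 T, 1 / (K t : ℝ) ≤ ∑ t ∈ Finset.Icc 1 T, 1 / (K t : ℝ) :=
    Finset.sum_le_sum_of_subset_of_nonneg Finset.Ico_subset_Icc_self fun _ _ _ => by positivity
  have havg : ∀ t ∈ Set.Icc 1 T, average (xs t) ∈ X := fun t ht =>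
    average_mem _ hX hn (hxmem t ht)
  set q := Real.exp (-(1 / ρ)) with hq
  have hq0 : 0 < q := Real.exp_pos _
  have hh0 : ∀ t ∈ Set.Icc 1 T,
      0 ≤ globalLoss f t (average (xs t)) - globalLoss f t (xstar t) := fun t ht =>
    sub_nonneg.2 ((hstar t ht).2 _ (havg t ht))
  refine (sum_le_of_succ_le (b := fun t =>
    2 * n * (⨆ i : Fin n, ⨆ x : X, |f i (t + 1) x - f i t x|) + B * (1 / (K t : ℝ)))
    hT hq0.le (hh0 T ⟨hT, le_rfl⟩) fun t ht => ?_).trans ?_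
  · have ht' : t ∈ Set.Icc 1 T := ⟨ht.1, ht.2.le⟩
    have ht1 : t + 1 ∈ Set.Icc 1 T := ⟨by omega, ht.2⟩
    have h1 := (hround t ht').suboptimality_final_le hX (hnet t ht') (hαmem t ht') hn
      (hK t ht') hζ hM0 hM hGX.le hL.le
      (fun i x hx z hz => (hf i t ht').isTangentGradient.norm_sub_le hGX.le hX hx hz)
      (fun i z hz => (hf i t ht').isTangentGradient.norm_le hGX.le hX
        (hf i t ht').lipschitz hL.le hz)
      (fun i => (hf i t ht').isTangentGradient) (hstar t ht').1 x₁
    simp only [hstate_one t ht', hstate_last t ht', hKα t ht', ← globalLoss.eq_1] at h1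
    have h2 : (1 - α t) ^ K t ≤ q := by
      calc (1 - α t) ^ K t ≤ Real.exp (-α t) ^ K t :=
            pow_le_pow_left₀ (sub_nonneg.2 (hαmem t ht').2) (Real.one_sub_le_exp_neg _) _
        _ = q := by rw [← Real.exp_nat_mul, mul_neg, hKα t ht']
    have h3 := mul_le_mul_of_nonneg_right h2 (hh0 t ht')
    have h4 : α t * (M * (D₁ ζ M L GX x₁ + 1 / ρ * D₂ n ζ M GX)
        + 1 / ρ * (n * GX * M ^ 2 / 2)) ≤ B * (1 / (K t : ℝ)) := by
      -- One factor `1 / ρ` is given away here; the other comes from `α t`.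
      have hle : 1 / ρ * (n * GX * M ^ 2 / 2) ≤ n * GX * M ^ 2 / 2 :=
        mul_le_of_le_one_left (by positivity) (div_le_one_of_le₀ hρ hρ0.le)
      calc _ ≤ α t * (M * (D₁ ζ M L GX x₁ + 1 / ρ * D₂ n ζ M GX) + n * GX * M ^ 2 / 2) :=
            mul_le_mul_of_nonneg_left (add_le_add_right hle _) (hαmem t ht').1
        _ = _ := by
            have := hKpos t ht'
            rw [hα t ht', hB]
            field_simp
    -- The loss is exchanged at the new average and at the new minimizer, whence `2 * n`; by `h7`
    -- the old minimizer is at least as good for the old loss.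
    have h5 := abs_le.1 (abs_globalLoss_succ_sub_le hM hL.le hf ht (havg (t + 1) ht1))
    have h6 := abs_le.1 (abs_globalLoss_succ_sub_le hM hL.le hf ht (hstar (t + 1) ht1).1)
    have h7 := (hstar t ht').2 _ (hstar (t + 1) ht1).1
    linarith
  · rw [Finset.sum_add_distrib, ← Finset.mul_sum, ← Finset.mul_sum, ← functionVariation]
    have h1 := (le_abs_self _).trans (abs_globalLoss_sub_le (fun i => hf i 1 h1T)
      (havg 1 h1T) (hstar 1 h1T).1)
    have h2 := mul_le_mul_of_nonneg_left (hM _ (havg 1 h1T) _ (hstar 1 h1T).1) hL.le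
    have h3 : globalLoss f 1 (average (xs 1)) - globalLoss f 1 (xstar 1) ≤ n * L * M := by
      rw [mul_assoc]
      exact h1.trans (by gcongr)
    have := D₁_nonneg (GX := GX) x₁ hn hζ hσ hM0 hL.le hGX.le
    have := D₂_nonneg (M := M) hn hζ hσ hM0 hGX.le
    have hB0 : 0 ≤ B := by rw [hB]; positivity
    have := mul_le_mul_of_nonneg_left hsubR hB0
    linarith

end IsRun

/-! ### Comparison with the final constants. -/

section constants

variable {ζ M L GX ρ : ℝ}

/-- The coefficients of the two error sources are dominated by `E₁` and `E₃`. -/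
theorem error_terms_le_E {K₁ : ℕ} {R B : ℝ} (x₁ : Fin n → EuclideanSpace ℝ (Fin d)) (hn : 0 < n)
    (hζ : 0 < ζ) (hσ : 0 < sigma n ζ) (hM0 : 0 ≤ M) (hL : 0 ≤ L) (hGX : 0 ≤ GX) (hρ : 0 < ρ)
    (hR0 : 0 ≤ R) (hK : 1 ≤ K₁)
    (hB : B = M * (1 / ρ * (D₁ ζ M L GX x₁ + 1 / ρ * D₂ n ζ M GX))
      + n * GX * M ^ 2 / (2 * ρ)) :
    n * L * ((spread x₁ + n * M / (ρ * (1 - sigma n ζ)) * R) / (1 - sigma n ζ ^ K₁))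
      + (n * L * M + B * R) * (1 - Real.exp (-(1 / ρ)))⁻¹
      ≤ E₁ ζ M L ρ K₁ x₁ + E₃ ζ M L GX ρ K₁ x₁ * R := by
  have hn1 : (1 : ℝ) ≤ n := by exact_mod_cast hn
  have hσ1 : sigma n ζ < 1 := sigma_lt_one hn hζ
  have hΓ := one_le_Gam hn hζ hσ
  have hP : 0 < 1 - sigma n ζ ^ K₁ := sub_pos.2 (pow_lt_one₀ hσ.le hσ1 (by omega))
  have hp : 0 < 1 - sigma n ζ := sub_pos.2 hσ1
  have hS0 := spread_nonneg x₁
  have hS1 : spread x₁ ≤ ∑ i, ‖x₁ i‖ := (spread_le_l2 _ hn).trans (l2_le_sum _)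
  have hD₁ := D₁_nonneg x₁ hn hζ hσ hM0 hL hGX
  have hD₂ := D₂_nonneg hn hζ hσ hM0 hGX
  have hfirst : n * L * ((spread x₁ + n * M / (ρ * (1 - sigma n ζ)) * R) / (1 - sigma n ζ ^ K₁))
      ≤ (n : ℝ) ^ 2 * L * Gam n ζ / (1 - sigma n ζ ^ K₁) * ∑ i, ‖x₁ i‖
        + (n : ℝ) ^ 2 * L * M / ρ *
          (n * Gam n ζ / (sigma n ζ * (1 - sigma n ζ) * (1 - sigma n ζ ^ K₁)) + 2) * R := by
    -- The factor `1` in the denominator stands where `sigma n ζ ≤ 1` is to be put.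
    have e : n * L * ((spread x₁ + n * M / (ρ * (1 - sigma n ζ)) * R) / (1 - sigma n ζ ^ K₁))
        = n * L / (1 - sigma n ζ ^ K₁) * spread x₁
          + (n : ℝ) ^ 2 * L * M / ρ * (1 / (1 * (1 - sigma n ζ) * (1 - sigma n ζ ^ K₁))) * R := by
      field_simp
    have hnΓ : 1 ≤ n * Gam n ζ := by nlinarith
    have hcoef : n * L ≤ (n : ℝ) ^ 2 * L * Gam n ζ := by
      have : 0 ≤ n * L := by positivity
      nlinarith
    have hfrac : 1 / (1 * (1 - sigma n ζ) * (1 - sigma n ζ ^ K₁))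
        ≤ n * Gam n ζ / (sigma n ζ * (1 - sigma n ζ) * (1 - sigma n ζ ^ K₁)) := by
      gcongr
    rw [e]
    gcongr
    linarith
  have hsecond : B ≤ 2 * M * (1 / ρ * D₁ ζ M L GX x₁ + 1 / ρ ^ 2 * D₂ n ζ M GX)
      + n * GX * M ^ 2 / (2 * ρ) := by
    have e : B = M * (1 / ρ * D₁ ζ M L GX x₁ + 1 / ρ ^ 2 * D₂ n ζ M GX)
        + n * GX * M ^ 2 / (2 * ρ) := by rw [hB]; field_simp
    have : 0 ≤ M * (1 / ρ * D₁ ζ M L GX x₁ + 1 / ρ ^ 2 * D₂ n ζ M GX) := by positivity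
    linarith
  have hthird : 0 ≤ n * L * ∑ i, ‖x₁ i - average x₁‖ := by positivity
  have hc : 0 ≤ (1 - Real.exp (-(1 / ρ)))⁻¹ :=
    inv_nonneg.2 (sub_nonneg.2 (Real.exp_le_one_iff.2 (by simpa using hρ.le)))
  have hsecond' := mul_le_mul_of_nonneg_right hsecond (mul_nonneg hc hR0)
  rw [E₁, E₃]
  linarith

end constants

end DOMFW

/-! ### The regret bound. -/

theorem theorem1 {n d : ℕ} (T : ℕ) (hT : 2 ≤ T)
    (X : Set (EuclideanSpace ℝ (Fin d))) (hXconv : Convex ℝ X) (hXcomp : IsCompact X)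
    (M : ℝ) (hM : ∀ x ∈ X, ∀ z ∈ X, ‖x - z‖ ≤ M)
    (ζ : ℝ) (hζ : 0 < ζ)
    (G : ℕ → Digraph (Fin n)) (A : ℕ → Matrix (Fin n) (Fin n) ℝ)
    (hnet : ∀ t ∈ Set.Icc 1 T, DOMFW.IsNetwork ζ (G t) (A t))
    (L GX : ℝ) (hL : 0 < L) (hGX : 0 < GX)
    (f : Fin n → ℕ → EuclideanSpace ℝ (Fin d) → ℝ)
    (hf : ∀ i, ∀ t ∈ Set.Icc 1 T, DOMFW.IsLoss X L GX (f i t))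
    (K : ℕ → ℕ) (hKmono : MonotoneOn K (Set.Icc 1 T)) (hK : ∀ t ∈ Set.Icc 1 T, 2 ≤ K t)
    (ρ : ℝ) (hρ : 1 ≤ ρ)
    (α : ℕ → ℝ) (hα : ∀ t ∈ Set.Icc 1 T, α t = 1 / (ρ * (K t : ℝ)))
    (w : DOMFW.Variables n d) (hw : DOMFW.IsRun X T G A f K α w)
    (xstar : ℕ → EuclideanSpace ℝ (Fin d))
    (hstar : ∀ t ∈ Set.Icc 1 T,
      xstar t ∈ X ∧ ∀ y ∈ X, DOMFW.globalLoss f t (xstar t) ≤ DOMFW.globalLoss f t y)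
    (j : Fin n) :
    DOMFW.dynamicRegret f T (w.x j) xstar ≤
      DOMFW.E₁ ζ M L ρ (K 1) (fun i => w.x i 1)
        + DOMFW.E₂ n ρ * DOMFW.functionVariation X f T
        + DOMFW.E₃ ζ M L GX ρ (K 1) (fun i => w.x i 1)
          * ∑ t ∈ Finset.Icc 1 T, 1 / (K t : ℝ) := by
  open DOMFW in
  have hn : 0 < n := j.pos
  have hρ0 : 0 < ρ := by linarith
  have hM0 : 0 ≤ M := (norm_nonneg _).trans (hM _ (hw.init j) _ (hw.init j))
  have h1T : (1 : ℕ) ∈ Set.Icc 1 T := ⟨le_rfl, by omega⟩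
  have hK1 : ∀ t ∈ Set.Icc 1 T, 1 ≤ K t := fun t ht => one_le_two.trans (hK t ht)
  have hσ : 0 < sigma n ζ := (hnet 1 h1T).sigma_pos j
  have hxmem : ∀ t ∈ Set.Icc 1 T, ∀ i, w.x i t ∈ X := fun t ht =>
    hw.x_mem hXconv hnet (fun t ht => IsRun.step_mem_Icc hρ (hK1 t ht) (hα t ht))
      ⟨ht.1, ht.2.trans T.le_succ⟩
  set xs : ℕ → Fin n → EuclideanSpace ℝ (Fin d) := fun t i => w.x i t with hxs
  have havg : ∀ t ∈ Set.Icc 1 T, average (xs t) ∈ X := fun t ht =>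
    average_mem _ hXconv hn (hxmem t ht)
  -- Each decision is compared with the network average, from which it differs by at most the
  -- spread.
  have hsplit : dynamicRegret f T (w.x j) xstar ≤ n * L * ∑ t ∈ Finset.Icc 1 T, spread (xs t)
      + ∑ t ∈ Finset.Icc 1 T, (globalLoss f t (average (xs t)) - globalLoss f t (xstar t)) := by
    rw [dynamicRegret, ← Finset.sum_sub_distrib, Finset.mul_sum, ← Finset.sum_add_distrib]
    refine Finset.sum_le_sum fun t ht => ?_
    have ht' : t ∈ Set.Icc 1 T := Finset.mem_Icc.1 ht
    have h1 := (le_abs_self _).trans (abs_globalLoss_sub_le (fun i => hf i t ht')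
      (hxmem t ht' j) (havg t ht'))
    have h2 : ‖w.x j t - average (xs t)‖ ≤ spread (xs t) := norm_le_l2 (center (xs t)) j
    have h3 : (n : ℝ) * (L * ‖w.x j t - average (xs t)‖) ≤ n * (L * spread (xs t)) := by gcongr
    linarith
  have hP : 0 < 1 - sigma n ζ ^ K 1 :=
    sub_pos.2 (pow_lt_one₀ hσ.le (sigma_lt_one hn hζ) (by have := hK1 1 h1T; omega))
  have hc : 0 < 1 - Real.exp (-(1 / ρ)) :=
    sub_pos.2 (Real.exp_lt_one_iff.2 (by simpa using hρ0))
  have hspread := hw.sum_spread_le hXconv hnet hζ h1T.2 hM hK1 hρ hα hKmono j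
  have hsubopt := hw.sum_suboptimality_le hXconv hnet hζ h1T.2 hM hK1 hρ hα hL hGX hf hstar j rfl
  have hE := error_terms_le_E (R := ∑ t ∈ Finset.Icc 1 T, 1 / (K t : ℝ)) (fun i => w.x i 1) hn hζ
    hσ hM0 hL.le hGX.le hρ0 (Finset.sum_nonneg fun _ _ => by positivity) (hK1 1 h1T) rfl
  rw [mul_comm, ← le_div_iff₀ hP] at hspread
  rw [mul_comm, ← le_div_iff₀ hc, div_eq_mul_inv] at hsubopt
  have hspread' := mul_le_mul_of_nonneg_left hspread (by positivity : 0 ≤ (n : ℝ) * L)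
  rw [E₂]
  linarith
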